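/- Let $G$ be a compact connected Lie group with Lie algebra $\mathfrak g$ and let $\langle\cdot,\cdot\rangle$ be an $\mathrm{Ad}_G$-invariant scalar product on $\mathfrak g$. Let $a\in\mathfrak g$, let $\mathcal O(a)=\mathrm{Ad}_G(a)$ be its adjoint orbit, and let $\varepsilon\in\mathbb R$. For $x\in\mathfrak g$ put $\mathrm{ann}(x)=\{\eta\in\mathfrak g\mid[\eta,x]=0\}$, let $\mathrm{pr}_{\mathrm{ann}(x)}$ be the orthogonal projection onto $\mathrm{ann}(x)$, let $\mathrm{ad}_x=[x,\cdot\,]$, and let $\mathrm{ad}_x^{-1}:[\mathfrak g,x]\to\mathrm{ann}(x)^\perp$ be the inverse of $\mathrm{ad}_x|_{\mathrm{ann}(x)^\perp}$. For $x\in\mathcal O(a)$ one has $T_x\mathcal O(a)=[\mathfrak g,x]=\mathrm{ann}(x)^\perp$. The Kirillov–Konstant form on $\mathcal O(a)$ is $\Omega(\eta_1,\eta_2)|_x=-\langle x,[\xi_1,\xi_2]\rangle$ for $\eta_i=[\xi_i,x]$, and the normal metric is $K_0(\eta_1,\eta_2)|_x=\langle\xi_1,\xi_2\rangle$ for $\eta_i=[\xi_i,x]$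 with $\xi_i\in\mathrm{ann}(x)^\perp$. Let $\varphi$ be a symmetric positive definite operator on $\mathrm{ann}(a)^\perp$ that commutes with $\mathrm{Ad}_g$ for all $g\in G$ with $\mathrm{Ad}_g a=a$. For $x=\mathrm{Ad}_g a$ put $\varphi_x=\mathrm{Ad}_g\circ\varphi\circ\mathrm{Ad}_{g^{-1}}:T_x\mathcal O(a)\to T_x\mathcal O(a)$, and let $K_\varphi(\eta_1,\eta_2)|_x=\langle\varphi_x\eta_1,\eta_2\rangle$ be the corresponding $G$-invariant metric. Realise the cotangent bundle as $T^*\mathcal O(a)=\{(x,p)\in\mathfrak g\times\mathfrak g\mid x\in\mathcal O(a),\ p\in\mathrm{ann}(x)^\perp\}$, with the pairing $p(\eta)=\langle p,\eta\rangle$, let $\omega$ be the restriction to it of $\sum dp_i\wedge dx_i$ (coordinates with respect to an orthonormal basis of $\mathfrak g$), and let $\rho(x,p)=x$. The magnetic geodesic flow of a metric $K$ on $\mathcal O(a)$ with magnetic term $\varepsilon\Omega$ is the flow on $T^*\mathcal O(a)$ of the Hamiltonian vector field $X$ given by $(\omega+\varepsilon\rho^*\Omega)(X,\cdot)=-dH$,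 where $H(x,p)=\frac12\langle p,v\rangle$ and $v\in T_x\mathcal O(a)$ is the vector with $K(v,\cdot)|_x=\langle p,\cdot\rangle$ on $T_x\mathcal O(a)$. **Theorem.** The magnetic geodesic flow of $K_\varphi$ with magnetic term $\varepsilon\Omega$ is given, in the redundant variables $(x,p)\in T^*\mathcal O(a)\subset\mathfrak g\times\mathfrak g$, by the equations $$\dot x=\varphi_x^{-1}p,\qquad \dot p=\mathrm{ad}_x^{-1}[p,\varphi_x^{-1}p]-\mathrm{pr}_{\mathrm{ann}(x)}[\mathrm{ad}_x^{-1}\varphi_x^{-1}p,\,p]-\varepsilon\,\mathrm{ad}_x^{-1}\varphi_x^{-1}p ,$$ where $p$, $\varphi_x^{-1}p$ and $[p,\varphi_x^{-1}p]$ lie in $T_x\mathcal O(a)$, so that all terms are defined. That is, the Hamiltonian vector field exists, is unique, and is given at each point of $T^*\mathcal O(a)$ by these right-hand sides; and a curve in $T^*\mathcal O(a)$ is a trajectory of the flow if and only if it satisfies these equations. In the same sense, the magnetic geodesic flow of the normal metric $K_0$ with magnetic term $\varepsilon\Omega$ is given by $$\dot x=[[x,p],x],\qquad \dot p=[[x,p],p]+\varepsilon[x,p].$$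 -/

import Mathlib

open scoped Manifold ContDiff Topology

noncomputable section

/-! ### The adjoint action of a Lie group -/

/-- A smooth real Lie group carries the regularity required for the bracket on its Lie algebra. -/
instance instLEInftyMinSmoothnessThree : ENat.LEInfty (minSmoothness ℝ 3) :=
  ⟨by
    rw [minSmoothness_of_isRCLikeNormedField]
    exact ENat.LEInfty.out⟩

section Adjoint

variable {n : ℕ} {G : Type*} [TopologicalSpace G] [ChartedSpace (EuclideanSpace ℝ (Fin n)) G]
  [Group G]

/-- The adjoint representation: `Ad g` is the derivative at the identity of `h ↦ g * h * g⁻¹`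
(which fixes the identity), as an endomorphism of the Lie algebra `𝔤 = T_e G`. -/
def Ad (g : G) : GroupLieAlgebra (𝓡 n) G →L[ℝ] GroupLieAlgebra (𝓡 n) G :=
  mfderiv (𝓡 n) (𝓡 n) (fun h : G => g * h * g⁻¹) (1 : G)

/-- The adjoint orbit `O(a) = Ad_G(a)`. -/
def adjointOrbit (a : GroupLieAlgebra (𝓡 n) G) : Set (GroupLieAlgebra (𝓡 n) G) :=
  Set.range fun g : G => Ad g a

theorem Ad_one (v : GroupLieAlgebra (𝓡 n) G) : Ad (1 : G) v = v := by
  have h : (fun x : G => (1 : G) * x * (1 : G)⁻¹) = id := by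
    funext x
    simp
  unfold Ad
  rw [h, mfderiv_id]
  rfl

variable [LieGroup (𝓡 n) ∞ G]

theorem Ad_mul (g h : G) (v : GroupLieAlgebra (𝓡 n) G) : Ad (g * h) v = Ad g (Ad h v) := by
  have hd : ∀ (k y : G),
      MDifferentiableAt (𝓡 n) (𝓡 n) (fun x : G => k * x * k⁻¹) y := by
    intro k y
    have : ContMDiff (𝓡 n) (𝓡 n) ∞ (fun x : G => k * x * k⁻¹) :=
      (contMDiff_mul_right (a := k⁻¹)).comp (contMDiff_mul_left (a := k))
    exact (this y).mdifferentiableAt (by simp)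
  have hcomp : (fun x : G => g * h * x * (g * h)⁻¹)
      = (fun x : G => g * x * g⁻¹) ∘ (fun x : G => h * x * h⁻¹) := by
    funext x
    simp [mul_assoc]
  have key := mfderiv_comp (1 : G) (hd g (h * 1 * h⁻¹)) (hd h 1)
  have h1 : h * 1 * h⁻¹ = (1 : G) := by simp
  unfold Ad
  rw [hcomp, key]
  have aux : ∀ y : G, y = 1 → ∀ u : EuclideanSpace ℝ (Fin n),
      (mfderiv (𝓡 n) (𝓡 n) (fun x : G => g * x * g⁻¹) y
        : EuclideanSpace ℝ (Fin n) →L[ℝ] EuclideanSpace ℝ (Fin n)) u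
      = (mfderiv (𝓡 n) (𝓡 n) (fun x : G => g * x * g⁻¹) (1 : G)
        : EuclideanSpace ℝ (Fin n) →L[ℝ] EuclideanSpace ℝ (Fin n)) u := by
    rintro y rfl u
    rfl
  exact aux _ h1 _

theorem Ad_inv_Ad (g : G) (v : GroupLieAlgebra (𝓡 n) G) : Ad g⁻¹ (Ad g v) = v := by
  rw [← Ad_mul, inv_mul_cancel, Ad_one]

/-- An `Ad_G`-invariant scalar product on the Lie algebra of `G`. -/
structure IsInvariantScalarProduct (B : LinearMap.BilinForm ℝ (GroupLieAlgebra (𝓡 n) G)) :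
    Prop where
  symm : ∀ x y, B x y = B y x
  pos : ∀ x, x ≠ 0 → 0 < B x x
  inv : ∀ (g : G) (x y), B (Ad g x) (Ad g y) = B x y

end Adjoint

/-! ### Tangent vectors and curves in a subset of a vector space -/

section Tangent

variable {V : Type*} [AddCommGroup V] [Module ℝ V] [TopologicalSpace V] [ContinuousSMul ℝ V]

/-- `γ` is a curve in `M` through `z` at time `0`, with velocity `Y` there. -/
structure IsCurveIn (M : Set V) (z Y : V) (γ : ℝ → V) : Prop where
  base : γ 0 = z
  mem : ∀ᶠ s in 𝓝 (0 : ℝ), γ s ∈ M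
  deriv : HasDerivAt γ Y 0

/-- The tangent space at `z` of a submanifold `M` of a vector space: the velocities of the curves
in `M` through `z`. -/
def tangentVectors (M : Set V) (z : V) : Set V := {Y | ∃ γ : ℝ → V, IsCurveIn M z Y γ}

end Tangent

/-! ### Linear algebra in a Lie algebra with a scalar product `B = ⟨·,·⟩` -/

section LieAlg

variable {L : Type*} [LieRing L] [LieAlgebra ℝ L]

/-- The annihilator `ann(x) = {η | [η, x] = 0}`. -/
def ann (x : L) : Submodule ℝ L where
  carrier := {η | ⁅η, x⁆ = 0}
  add_mem' {u v} hu hv := by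
    have hu' : ⁅u, x⁆ = 0 := hu
    have hv' : ⁅v, x⁆ = 0 := hv
    show ⁅u + v, x⁆ = 0
    rw [add_lie, hu', hv', add_zero]
  zero_mem' := zero_lie x
  smul_mem' c u hu := by
    have hu' : ⁅u, x⁆ = 0 := hu
    show ⁅c • u, x⁆ = 0
    rw [smul_lie, hu', smul_zero]

/-- The orthogonal complement `ann(x)^⊥` with respect to the scalar product `B`. -/
def annPerp (B : LinearMap.BilinForm ℝ L) (x : L) : Submodule ℝ L := B.orthogonal (ann x)

/-- The orthogonal projection of `y` on the subspace `W`: the element `w` of `W` such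
that `y - w` is orthogonal to `W`. -/
def orthProj (B : LinearMap.BilinForm ℝ L) (W : Submodule ℝ L) (y : L) : L :=
  Classical.epsilon fun w : L => w ∈ W ∧ y - w ∈ B.orthogonal W

/-- `ad_x⁻¹`: the inverse of the bijection `ad_x = [x, ·]` from `ann(x)^⊥` onto `[𝔤, x]`. -/
def adInv (B : LinearMap.BilinForm ℝ L) (x η : L) : L :=
  Function.invFunOn (fun ξ : L => ⁅x, ξ⁆) (annPerp B x) η

/-- The element `ξ` of `ann(x)^⊥` such that `η = [ξ, x]`, for `η` in `[𝔤, x]`. -/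
def orbitGen (B : LinearMap.BilinForm ℝ L) (x η : L) : L :=
  Function.invFunOn (fun ξ : L => ⁅ξ, x⁆) (annPerp B x) η

/-- The Kirillov-Kostant form `Ω_x(η₁, η₂) = -⟨x, [ξ₁, ξ₂]⟩`, `ηᵢ = [ξᵢ, x]`. -/
def kirillovForm (B : LinearMap.BilinForm ℝ L) (x η₁ η₂ : L) : ℝ :=
  -B x ⁅orbitGen B x η₁, orbitGen B x η₂⁆

/-- The normal metric `K₀(η₁, η₂)|_x = ⟨ξ₁, ξ₂⟩`, `ηᵢ = [ξᵢ, x]`, `ξᵢ ∈ ann(x)^⊥`. -/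
def normalMetric (B : LinearMap.BilinForm ℝ L) (x η₁ η₂ : L) : ℝ :=
  B (orbitGen B x η₁) (orbitGen B x η₂)

/-- The cotangent bundle of the orbit `O`, realised in `𝔤 × 𝔤` as the set of `(x, p)` with
`x ∈ O` and `p ∈ ann(x)^⊥`; here `p` acts on `T_x O` by `η ↦ ⟨p, η⟩`. -/
def cotangentOrbit (B : LinearMap.BilinForm ℝ L) (O : Set L) : Set (L × L) :=
  {z | z.1 ∈ O ∧ z.2 ∈ annPerp B z.1}

/-- The magnetic symplectic form `ω + ε ρ^*Ω` at a point over `x`, where `ω = ∑ dpᵢ ∧ dxᵢ` in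
orthonormal coordinates and `ρ (x, p) = x`. -/
def magneticForm (B : LinearMap.BilinForm ℝ L) (ε : ℝ) (x : L) (X Y : L × L) : ℝ :=
  (B X.2 Y.1 - B Y.2 X.1) + ε * kirillovForm B x X.1 Y.1

variable [TopologicalSpace L] [ContinuousSMul ℝ L]

/-- The inverse of the Legendre transformation `T_x O → T_x^* O` of the metric `K` on `O`: the
vector `v ∈ T_x O` such that `K_x(v, η) = ⟨p, η⟩` for all `η ∈ T_x O`. -/
def legendreInv (B : LinearMap.BilinForm ℝ L) (O : Set L) (K : L → L → L → ℝ) (x p : L) : L :=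
  Classical.epsilon fun v : L =>
    v ∈ tangentVectors O x ∧ ∀ η ∈ tangentVectors O x, K x v η = B p η

/-- The Hamiltonian `H(x, p) = ½ ∑ g^{ij} pᵢ pⱼ` of the metric `K` on `O`. -/
def hamiltonian (B : LinearMap.BilinForm ℝ L) (O : Set L) (K : L → L → L → ℝ) (z : L × L) : ℝ :=
  (1 / 2) * B z.2 (legendreInv B O K z.1 z.2)

/-- `X` is the value at `z ∈ T^*O` of the Hamiltonian vector field of the Hamiltonian of the metric
`K` on `(T^*O, ω + ε ρ^*Ω)`: `X` is tangent to `T^*O`, and `(ω + ε ρ^*Ω)(X, Y) = -dH(Y)` for every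
tangent vector `Y` (in canonical coordinates, with `Ω = ∑_{i<j} F_{ij} dxⁱ ∧ dxʲ`, these are the
equations `ẋⁱ = ∂H/∂pᵢ`, `ṗᵢ = -∂H/∂xⁱ + ε ∑ⱼ F_{ij} ∂H/∂pⱼ`). -/
structure IsMagneticVector (B : LinearMap.BilinForm ℝ L) (O : Set L) (K : L → L → L → ℝ) (ε : ℝ)
    (z X : L × L) : Prop where
  tangent : X ∈ tangentVectors (cotangentOrbit B O) z
  hamilton : ∀ (Y : L × L) (γ : ℝ → L × L), IsCurveIn (cotangentOrbit B O) z Y γ →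
    HasDerivAt (fun s => hamiltonian B O K (γ s)) (-magneticForm B ε z.1 X Y) 0

/-- `t ↦ (x t, p t)`, `t ∈ J`, is a trajectory in `T^*O` of the magnetic geodesic flow on `(O, K)`
with magnetic term `εΩ`. -/
def IsMagneticTrajectory (B : LinearMap.BilinForm ℝ L) (O : Set L) (K : L → L → L → ℝ) (ε : ℝ)
    (J : Set ℝ) (x p : ℝ → L) : Prop :=
  ∀ t ∈ J, (x t, p t) ∈ cotangentOrbit B O ∧
    ∃ X : L × L, HasDerivAt (fun s => (x s, p s)) X t ∧ IsMagneticVector B O K ε (x t, p t) X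

end LieAlg

/-! ### `G`-invariant metrics on adjoint orbits -/

section Metric

variable {n : ℕ} {G : Type*} [TopologicalSpace G] [ChartedSpace (EuclideanSpace ℝ (Fin n)) G]
  [Group G] [LieGroup (𝓡 n) ∞ G]
  (B : LinearMap.BilinForm ℝ (GroupLieAlgebra (𝓡 n) G)) (a : GroupLieAlgebra (𝓡 n) G)

/-- `φ` is an `Ad_{G_a}`-invariant positive definite (symmetric) operator on `ann(a)^⊥`. The
invariance `φ (Ad_g v) = Ad_g (φ v)` for `g ∈ G_a` is written with `w = Ad_g v`. -/
structure IsInvariantOperator (φ : annPerp B a →ₗ[ℝ] annPerp B a) : Prop where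
  symm : ∀ v w : annPerp B a, B (φ v) w = B v (φ w)
  pos : ∀ v : annPerp B a, v ≠ 0 → 0 < B (φ v) v
  inv : ∀ g : G, Ad g a = a → ∀ v w : annPerp B a,
    (w : GroupLieAlgebra (𝓡 n) G) = Ad g v → (φ w : GroupLieAlgebra (𝓡 n) G) = Ad g (φ v)

variable {B a}

open Classical in
/-- `φ_x = Ad_g ∘ φ ∘ Ad_{g⁻¹} : T_x O(a) → T_x O(a)` for `x = Ad_g a`. It does not depend on the
choice of `g`, see `phiAt_Ad`. -/
def phiAt (φ : annPerp B a →ₗ[ℝ] annPerp B a) (x v : GroupLieAlgebra (𝓡 n) G) :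
    GroupLieAlgebra (𝓡 n) G :=
  if h : ∃ g : G, Ad g a = x ∧ Ad g⁻¹ v ∈ annPerp B a then
    Ad h.choose (φ ⟨Ad h.choose⁻¹ v, h.choose_spec.2⟩ : GroupLieAlgebra (𝓡 n) G)
  else 0

theorem phiAt_Ad {φ : annPerp B a →ₗ[ℝ] annPerp B a} (hφ : IsInvariantOperator B a φ) (g : G)
    (v : annPerp B a) : phiAt φ (Ad g a) (Ad g v) = Ad g (φ v) := by
  have h : ∃ k : G, Ad k a = Ad g a ∧ Ad k⁻¹ (Ad g v) ∈ annPerp B a :=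
    ⟨g, rfl, by rw [Ad_inv_Ad]; exact v.2⟩
  rw [phiAt, dif_pos h]
  obtain ⟨h1, h2⟩ := h.choose_spec
  set k := h.choose
  have hk : Ad (k⁻¹ * g) a = a := by rw [Ad_mul, ← h1, Ad_inv_Ad]
  rw [hφ.inv (k⁻¹ * g) hk v ⟨Ad k⁻¹ (Ad g v), h2⟩ (Ad_mul _ _ _).symm, ← Ad_mul,
    mul_inv_cancel_left]

/-- The `G`-invariant metric `K_φ(η₁, η₂)|_x = ⟨φ_x η₁, η₂⟩` on the orbit `O(a)`. -/
def invariantMetric (φ : annPerp B a →ₗ[ℝ] annPerp B a) (x η₁ η₂ : GroupLieAlgebra (𝓡 n) G) : ℝ :=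
  B (phiAt φ x η₁) η₂

/-- `φ_x⁻¹`, the inverse of `φ_x : T_x O(a) → T_x O(a)`. -/
def phiInvAt (φ : annPerp B a →ₗ[ℝ] annPerp B a) (x p : GroupLieAlgebra (𝓡 n) G) :
    GroupLieAlgebra (𝓡 n) G :=
  Function.invFunOn (phiAt φ x) (tangentVectors (adjointOrbit a) x) p

end Metric

end

/-!
Write `⟨·,·⟩` for the scalar product. The tangent spaces in the statement are sets of velocities of
arbitrary differentiable curves, so the first point is to show that every curve in the orbit (or in
its cotangent bundle) is, near its starting point, moved by a differentiable curve in the group.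

The derivative of `Ad` at the identity is `ad` (`fderiv_adjointChart`), by a computation in the
chart of `G` at the identity. Hence `ad ξ` is skew for `⟨·,·⟩`, `𝔤 = ann(x) ⊕ ann(x)^⊥`, and `ad x`
is invertible on `ann(x)^⊥`. The map that sends `g` to the component of `Ad g x` in `ann(x)^⊥` is
therefore a submersion at the identity, and the component in `ann(x)^⊥` of a curve in the orbit
lifts to the group (`exists_lift_curve`). The lifted curve is the given one because, near `x`, two
points `y`, `z` of the orbit with `y - z ∈ ann(x)` coincide (`eventually_eq_of_sub_mem_ann`): `ad
y` and `ad z` are roots of the minimal polynomial `q` of `ad x`, which is separable since `ad x` is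
semisimple, and the derivative of `q` at `ad x`, in directions commuting with `ad x`, is
multiplication by the invertible operator `q'(ad x)`. So `ad y = ad z`, the difference `y - z` is
central, and a central element is fixed by the connected group `G`, whence `y - z` is orthogonal to
itself.

It follows that `T_x O(a) = ann(x)^⊥` and that the tangent vectors of the cotangent bundle at
`(x, p)` are the `Y = ([ξ, x], [ξ, p] + π)` with `π ∈ ann(x)^⊥`. For an invariant metric whose
inverse Legendre transformation at `x` is the symmetric operator `A` on `ann(x)^⊥`, the Hamiltonian
is invariant under the group, so that `dH(Y) = ⟨A p, π⟩`
(`IsInvariantCometric.hasDerivAt_hamiltonian`). The Hamilton equation for `(u, w)` tested on the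
vectors `(0, π)` gives `u = A p`; tested on `([ξ, x], [ξ, p])` it gives
`[x, w] = [p, A p] - ε A p`. The last equation determines the component of `w` in `ann(x)^⊥`, and
the tangency of `(A p, w)` to the cotangent bundle determines its component in `ann(x)`
(`IsAdInvariant.tangent_and_lie_eq_iff`); together they are the stated formula. Conversely this
formula satisfies both conditions, because `[p, A p]` is orthogonal to `ann(x)`
(`IsInvariantCometric.lie_mem`), by the invariance of `A` under the stabilizer of `x`.
The metric `K_φ` has `A = φ_x⁻¹`, and the normal metric has `A p = [[x, p], x]`.
-/

noncomputable section

/-! ### Polynomials in a noncommutative normed algebra -/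

section PolynomialCalculus

open Polynomial Filter

variable {R : Type*} [NormedRing R] [NormedAlgebra ℝ R]

/-- The derivative of `A ↦ q(A)` in a direction that commutes with the base point is given by the
formal derivative of `q`, as in the commutative case. -/
theorem hasStrictFDerivAt_aeval_commute (q : ℝ[X]) (A₀ : R) :
    ∃ D : R →L[ℝ] R, HasStrictFDerivAt (fun A : R => aeval A q) D A₀ ∧
      ∀ X : R, Commute X A₀ → D X = X * aeval A₀ (derivative q) := by
  induction q using Polynomial.induction_on' with
  | add p q hp hq =>
    obtain ⟨D, hD, hD'⟩ := hp
    obtain ⟨F, hF, hF'⟩ := hq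
    refine ⟨D + F, by simpa using! hD.add hF, fun X hX => ?_⟩
    simp [hD' X hX, hF' X hX, mul_add]
  | monomial k c =>
    have key : ∃ D : R →L[ℝ] R, HasStrictFDerivAt (fun A : R => A ^ k) D A₀ ∧
        ∀ X : R, Commute X A₀ → D X = (k : ℝ) • (X * A₀ ^ (k - 1)) := by
      induction k with
      | zero => exact ⟨0, by simpa using hasStrictFDerivAt_const (1 : R) A₀, by simp⟩
      | succ k ih =>
        obtain ⟨D, hD, hD'⟩ := ih
        refine ⟨_, by simpa only [pow_succ] using! hD.mul' (hasStrictFDerivAt_id A₀), ?_⟩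
        intro X hX
        have hpow : A₀ ^ k * X = X * A₀ ^ k := (hX.pow_right k).eq.symm
        rcases Nat.eq_zero_or_pos k with rfl | hk
        · simp [hD' X hX]
        · have hA : A₀ ^ (k - 1) * A₀ = A₀ ^ k := by
            rw [← pow_succ, Nat.sub_add_cancel hk]
          simp [hD' X hX, hpow, mul_assoc, hA, add_smul, add_comm]
    obtain ⟨D, hD, hD'⟩ := key
    refine ⟨c • D, by simpa [aeval_monomial, Algebra.smul_def] using! hD.const_smul c, ?_⟩
    intro X hX
    have hc : X * algebraMap ℝ R c = algebraMap ℝ R c * X := (Algebra.commutes c X).symm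
    have hk : X * (k : R) = k * X := ((Nat.cast_commute k X).eq).symm
    simp only [smul_apply, hD' X hX, derivative_monomial, aeval_monomial,
      Algebra.smul_def, map_mul, map_natCast, mul_assoc]
    rw [← mul_assoc X, hc, mul_assoc, ← mul_assoc X, hk, mul_assoc]

/-- Near a root `A₀` of a separable polynomial `q`, two elements with the same value of `q` coincide
as soon as their difference commutes with `A₀`. -/
theorem eventually_eq_of_aeval_eq (q : ℝ[X]) (A₀ : R) (hq : IsCoprime q (derivative q))
    (h0 : aeval A₀ q = 0) :
    ∀ᶠ A : R × R in 𝓝 (A₀, A₀), aeval A.1 q = aeval A.2 q → Commute (A.1 - A.2) A₀ →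
      A.1 = A.2 := by
  obtain ⟨D, hD, hD'⟩ := hasStrictFDerivAt_aeval_commute q A₀
  obtain ⟨u, w, huw⟩ := hq
  have hinv : aeval A₀ (derivative q) * aeval A₀ w = 1 := by
    have := congrArg (aeval A₀) huw
    rw [mul_comm w] at this
    simpa [h0] using this
  set c : ℝ := ‖aeval A₀ w‖
  have hc : 0 < (c + 1)⁻¹ := by positivity
  filter_upwards [(hasStrictFDerivAt_iff_isLittleO.1 hD).def hc] with A hA hAq hcomm
  -- on the commutant of `A₀` the derivative is multiplication by `q'(A₀)`, with inverse `w(A₀)`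
  rw [hAq, sub_self, zero_sub, norm_neg, hD' _ hcomm] at hA
  set X := A.1 - A.2
  have h1 : ‖X‖ ≤ ‖X * aeval A₀ (derivative q)‖ * c := by
    calc ‖X‖ = ‖X * aeval A₀ (derivative q) * aeval A₀ w‖ := by rw [mul_assoc, hinv, mul_one]
      _ ≤ _ := norm_mul_le _ _
  have h2 : ‖X‖ * (c + 1) ≤ ‖X‖ * c := by
    have hc0 : 0 ≤ c := norm_nonneg _
    calc ‖X‖ * (c + 1) ≤ ‖X * aeval A₀ (derivative q)‖ * c * (c + 1) := by gcongr
      _ ≤ ((c + 1)⁻¹ * ‖X‖) * c * (c + 1) := by gcongr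
      _ = ‖X‖ * c := by field_simp
  have h3 : ‖X‖ ≤ 0 := by linarith
  exact sub_eq_zero.1 (norm_le_zero_iff.1 h3)

end PolynomialCalculus

/-! ### Operators that are skew for a scalar product -/

section Skew

open Polynomial

variable {V : Type*} [AddCommGroup V] [Module ℝ V] [FiniteDimensional ℝ V]

theorem isCompl_orthogonal_of_pos {B : LinearMap.BilinForm ℝ V} (hs : ∀ x y, B x y = B y x)
    (hp : ∀ x, x ≠ 0 → 0 < B x x) (W : Submodule ℝ V) : IsCompl W (B.orthogonal W) := by
  have hrefl : B.IsRefl := fun x y h => by rw [hs, h]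
  rw [LinearMap.BilinForm.isCompl_orthogonal_iff_disjoint hrefl, Submodule.disjoint_def]
  intro x hx hx'
  by_contra h
  exact (hp x h).ne' (hx' x hx)

/-- A skew operator is semisimple, so its minimal polynomial is separable. -/
theorem isCoprime_minpoly_derivative_of_skew {B : LinearMap.BilinForm ℝ V}
    (hs : ∀ x y, B x y = B y x) (hp : ∀ x, x ≠ 0 → 0 < B x x) (f : Module.End ℝ V)
    (hf : ∀ x y, B (f x) y = -B x (f y)) :
    IsCoprime (minpoly ℝ f) (derivative (minpoly ℝ f)) := by
  have hss : f.IsSemisimple := by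
    rw [Module.End.isSemisimple_iff]
    intro W hW
    refine ⟨B.orthogonal W, ?_, isCompl_orthogonal_of_pos hs hp W⟩
    rw [Module.End.mem_invtSubmodule] at hW ⊢
    intro x hx w hw
    have h1 := hf w x
    have h2 : B (f w) x = 0 := hx (f w) (hW hw)
    show B w (f x) = 0
    linarith
  exact PerfectField.separable_iff_squarefree.2 hss.minpoly_squarefree

end Skew

/-! ### The derivative of the adjoint representation -/

section ChartOne

open Set Filter VectorField

variable {n : ℕ} {G : Type*} [TopologicalSpace G] [ChartedSpace (EuclideanSpace ℝ (Fin n)) G]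
  [Group G]

variable (n G) in
/-- The chart of `G` at the identity. -/
abbrev chartOne : PartialEquiv G (EuclideanSpace ℝ (Fin n)) := extChartAt (𝓡 n) (1 : G)

variable (n G) in
/-- The multiplication of `G` in the chart at the identity. -/
def mulChart (y z : EuclideanSpace ℝ (Fin n)) : EuclideanSpace ℝ (Fin n) :=
  chartOne n G ((chartOne n G).symm y * (chartOne n G).symm z)

variable (n G) in
/-- Conjugation in the chart at the identity. -/
def conjChart (y z : EuclideanSpace ℝ (Fin n)) : EuclideanSpace ℝ (Fin n) :=
  chartOne n G ((chartOne n G).symm y * (chartOne n G).symm z * ((chartOne n G).symm y)⁻¹)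

variable (n G) in
/-- The adjoint representation in the chart at the identity. -/
def adjointChart (y : EuclideanSpace ℝ (Fin n)) :
    EuclideanSpace ℝ (Fin n) →L[ℝ] EuclideanSpace ℝ (Fin n) :=
  Ad ((chartOne n G).symm y)

theorem chartOne_symm_self : (chartOne n G).symm (chartOne n G 1) = 1 :=
  extChartAt_to_inv (I := 𝓡 n) (1 : G)

theorem mulChart_one_right {y : EuclideanSpace ℝ (Fin n)} (hy : y ∈ (chartOne n G).target) :
    mulChart n G y (chartOne n G 1) = y := by
  rw [mulChart, chartOne_symm_self, mul_one, (chartOne n G).right_inv hy]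

theorem mulChart_one_left {y : EuclideanSpace ℝ (Fin n)} (hy : y ∈ (chartOne n G).target) :
    mulChart n G (chartOne n G 1) y = y := by
  rw [mulChart, chartOne_symm_self, one_mul, (chartOne n G).right_inv hy]

theorem conjChart_one_right (y : EuclideanSpace ℝ (Fin n)) :
    conjChart n G y (chartOne n G 1) = chartOne n G 1 := by
  rw [conjChart, chartOne_symm_self, mul_one, mul_inv_cancel]

theorem adjointChart_one : adjointChart n G (chartOne n G 1) = ContinuousLinearMap.id ℝ _ := by
  ext1 v
  rw [adjointChart, chartOne_symm_self]
  exact Ad_one v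

theorem chartOne_target_mem_nhds : (chartOne n G).target ∈ 𝓝 (chartOne n G 1) :=
  extChartAt_target_mem_nhds (I := 𝓡 n) (1 : G)

theorem mem_chartOne_target : chartOne n G 1 ∈ (chartOne n G).target :=
  mem_extChartAt_target (I := 𝓡 n) (1 : G)

theorem mem_chartOne_source : 1 ∈ (chartOne n G).source :=
  mem_extChartAt_source (I := 𝓡 n) (1 : G)

section Manifold

variable [IsManifold (𝓡 n) ∞ G]

theorem contMDiffAt_chartOne_symm {y : EuclideanSpace ℝ (Fin n)} (hy : y ∈ (chartOne n G).target) :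
    ContMDiffAt 𝓘(ℝ, EuclideanSpace ℝ (Fin n)) (𝓡 n) ∞ (chartOne n G).symm y :=
  (contMDiffOn_extChartAt_symm (1 : G)).contMDiffAt
    ((isOpen_extChartAt_target (I := 𝓡 n) (1 : G)).mem_nhds hy)

theorem contMDiffAt_chartOne {g : G} (hg : g ∈ (chartOne n G).source) :
    ContMDiffAt (𝓡 n) 𝓘(ℝ, EuclideanSpace ℝ (Fin n)) ∞ (chartOne n G) g :=
  contMDiffAt_extChartAt' (by simpa using hg)

end Manifold

variable [LieGroup (𝓡 n) ∞ G]

theorem contMDiffAt_chartOne_symm_fst (o : EuclideanSpace ℝ (Fin n))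
    (ho : o ∈ (chartOne n G).target) (o' : EuclideanSpace ℝ (Fin n)) :
    ContMDiffAt 𝓘(ℝ, EuclideanSpace ℝ (Fin n) × EuclideanSpace ℝ (Fin n)) (𝓡 n) ∞
      (fun p : EuclideanSpace ℝ (Fin n) × EuclideanSpace ℝ (Fin n) =>
        (chartOne n G).symm p.1) (o, o') :=
  ContMDiffAt.comp (o, o') (contMDiffAt_chartOne_symm ho)
    (contMDiffAt_iff_contDiffAt.2 contDiffAt_fst)

theorem contMDiffAt_chartOne_symm_snd (o : EuclideanSpace ℝ (Fin n))
    (ho : o ∈ (chartOne n G).target) (o' : EuclideanSpace ℝ (Fin n)) :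
    ContMDiffAt 𝓘(ℝ, EuclideanSpace ℝ (Fin n) × EuclideanSpace ℝ (Fin n)) (𝓡 n) ∞
      (fun p : EuclideanSpace ℝ (Fin n) × EuclideanSpace ℝ (Fin n) =>
        (chartOne n G).symm p.2) (o', o) :=
  ContMDiffAt.comp (o', o) (contMDiffAt_chartOne_symm ho)
    (contMDiffAt_iff_contDiffAt.2 contDiffAt_snd)

theorem contDiffAt_mulChart :
    ContDiffAt ℝ ∞ (Function.uncurry (mulChart n G)) (chartOne n G 1, chartOne n G 1) := by
  refine ContMDiffAt.contDiffAt (ContMDiffAt.comp _ (contMDiffAt_chartOne ?_)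
    ((contMDiffAt_chartOne_symm_fst _ mem_chartOne_target _).mul
      (contMDiffAt_chartOne_symm_snd _ mem_chartOne_target _)))
  simpa only [chartOne_symm_self, mul_one] using mem_chartOne_source

theorem contDiffAt_conjChart :
    ContDiffAt ℝ ∞ (Function.uncurry (conjChart n G)) (chartOne n G 1, chartOne n G 1) := by
  refine ContMDiffAt.contDiffAt (ContMDiffAt.comp _ (contMDiffAt_chartOne ?_)
    (((contMDiffAt_chartOne_symm_fst _ mem_chartOne_target _).mul
      (contMDiffAt_chartOne_symm_snd _ mem_chartOne_target _)).mul
      (contMDiffAt_chartOne_symm_fst _ mem_chartOne_target _).inv))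
  simpa only [chartOne_symm_self, mul_one, inv_one] using mem_chartOne_source

/-- `Ad g` is defined as a manifold derivative at the identity; since conjugation fixes the
identity, it is the derivative of conjugation read in the single chart `chartOne`. -/
theorem Ad_eq_fderiv (g : G) :
    (Ad g : EuclideanSpace ℝ (Fin n) →L[ℝ] EuclideanSpace ℝ (Fin n)) =
      fderiv ℝ (fun z => chartOne n G (g * (chartOne n G).symm z * g⁻¹)) (chartOne n G 1) := by
  have hd : MDifferentiableAt (𝓡 n) (𝓡 n) (fun h : G => g * h * g⁻¹) 1 := by
    have : ContMDiff (𝓡 n) (𝓡 n) ∞ (fun x : G => g * x * g⁻¹) :=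
      (contMDiff_mul_right (a := g⁻¹)).comp (contMDiff_mul_left (a := g))
    exact (this 1).mdifferentiableAt (by simp)
  have h1 : g * 1 * g⁻¹ = 1 := by simp
  have h2 : writtenInExtChartAt (𝓡 n) (𝓡 n) (1 : G) (fun h : G => g * h * g⁻¹) =
      fun z => chartOne n G (g * (chartOne n G).symm z * g⁻¹) := by
    funext z
    simp only [writtenInExtChartAt, h1, Function.comp]
  refine hd.mfderiv.trans ?_
  rw [h2]
  simp only [ModelWithCorners.range_eq_univ, fderivWithin_univ]
  rfl

theorem adjointChart_eq_fderiv (y : EuclideanSpace ℝ (Fin n)) :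
    adjointChart n G y = fderiv ℝ (conjChart n G y) (chartOne n G 1) :=
  Ad_eq_fderiv _

theorem contDiffAt_adjointChart : ContDiffAt ℝ ∞ (adjointChart n G) (chartOne n G 1) := by
  have h : adjointChart n G = fun y => fderiv ℝ (conjChart n G y) (chartOne n G 1) :=
    funext adjointChart_eq_fderiv
  rw [h]
  exact ContDiffAt.fderiv contDiffAt_conjChart contDiffAt_const (by simp)

/-- The left-invariant vector field with value `v` at the identity, in the chart at the identity. -/
theorem mulInvariantVectorField_chart (v : EuclideanSpace ℝ (Fin n)) :
    ∀ᶠ y in 𝓝 (chartOne n G 1),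
      (mpullbackWithin 𝓘(ℝ, EuclideanSpace ℝ (Fin n)) (𝓡 n) (chartOne n G).symm
        (mulInvariantVectorField (v : GroupLieAlgebra (𝓡 n) G)) (range (𝓡 n)) y :
          EuclideanSpace ℝ (Fin n)) = fderiv ℝ (mulChart n G y) (chartOne n G 1) v := by
  filter_upwards [chartOne_target_mem_nhds (n := n) (G := G)] with y hy
  set g := (chartOne n G).symm y with hg
  have hgs : g ∈ (chartOne n G).source := (chartOne n G).map_target hy
  have hinv : (mfderivWithin 𝓘(ℝ, EuclideanSpace ℝ (Fin n)) (𝓡 n) (chartOne n G).symm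
      (range (𝓡 n)) y).inverse = mfderiv (𝓡 n) 𝓘(ℝ, EuclideanSpace ℝ (Fin n)) (chartOne n G) g :=
    ContinuousLinearMap.inverse_eq
      (mfderivWithin_extChartAt_symm_comp_mfderiv_extChartAt hy)
      (mfderiv_extChartAt_comp_mfderivWithin_extChartAt_symm hy)
  have hL : MDifferentiableAt (𝓡 n) (𝓡 n) (fun h : G => g * h) 1 :=
    ((contMDiff_mul_left (I := 𝓡 n) (n := ∞) (a := g)) 1).mdifferentiableAt (by simp)
  have he : MDifferentiableAt (𝓡 n) 𝓘(ℝ, EuclideanSpace ℝ (Fin n)) (chartOne n G) (g * 1) :=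
    (contMDiffAt_chartOne (by rwa [mul_one])).mdifferentiableAt (by simp)
  have h2 : mfderiv (𝓡 n) 𝓘(ℝ, EuclideanSpace ℝ (Fin n)) (fun h => chartOne n G (g * h)) 1 =
      fderiv ℝ (mulChart n G y) (chartOne n G 1) := by
    refine (he.comp (1 : G) hL).mfderiv.trans ?_
    simp only [ModelWithCorners.range_eq_univ, fderivWithin_univ]
    rfl
  have h3 := mfderiv_comp (1 : G) he hL
  rw [mpullbackWithin_apply, hinv, ← h2]
  have h4 : mfderiv (𝓡 n) 𝓘(ℝ, EuclideanSpace ℝ (Fin n)) (fun h => chartOne n G (g * h)) 1 v =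
    mfderiv (𝓡 n) 𝓘(ℝ, EuclideanSpace ℝ (Fin n)) (chartOne n G) (g * 1)
      (mfderiv (𝓡 n) (𝓡 n) (fun h : G => g * h) 1 v) := DFunLike.congr_fun h3 v
  refine Eq.trans ?_ h4.symm
  have aux : ∀ k : G, k = g → ∀ u : EuclideanSpace ℝ (Fin n),
      (mfderiv (𝓡 n) 𝓘(ℝ, EuclideanSpace ℝ (Fin n)) (chartOne n G) g
        : EuclideanSpace ℝ (Fin n) →L[ℝ] EuclideanSpace ℝ (Fin n)) u
      = (mfderiv (𝓡 n) 𝓘(ℝ, EuclideanSpace ℝ (Fin n)) (chartOne n G) k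
        : EuclideanSpace ℝ (Fin n) →L[ℝ] EuclideanSpace ℝ (Fin n)) u := by
    rintro k rfl u
    rfl
  exact aux (g * 1) (mul_one g) _

/-- Mathlib's bracket on the Lie algebra, as a bracket of vector fields on the model space: the
derivative of the chart at the identity is the identity map. -/
theorem bracket_chart (v w : GroupLieAlgebra (𝓡 n) G) :
    (⁅v, w⁆ : GroupLieAlgebra (𝓡 n) G) =
      lieBracket ℝ (fun y => fderiv ℝ (mulChart n G y) (chartOne n G 1) v)
        (fun y => fderiv ℝ (mulChart n G y) (chartOne n G 1) w) (chartOne n G 1) := by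
  rw [GroupLieAlgebra.bracket_def, ← mlieBracketWithin_univ, mlieBracketWithin_apply]
  have h1 : (mfderiv (𝓡 n) 𝓘(ℝ, EuclideanSpace ℝ (Fin n)) (chartOne n G) 1).inverse =
      ContinuousLinearMap.id ℝ (EuclideanSpace ℝ (Fin n)) := by
    refine (congrArg ContinuousLinearMap.inverse (mfderiv_extChartAt_self (x := (1 : G)))).trans ?_
    exact ContinuousLinearMap.inverse_id
  refine (DFunLike.congr_fun h1 _).trans ?_
  have h2 : (extChartAt (𝓡 n) (1 : G)).symm ⁻¹' univ ∩ range (𝓡 n) = univ := by simp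
  refine (Filter.EventuallyEq.lieBracketWithin_vectorField_eq_nhds
    (mulInvariantVectorField_chart v) (mulInvariantVectorField_chart w)).trans ?_
  rw [h2, lieBracketWithin_univ]

/-- The identity `y z = (y z y⁻¹) y` in the chart at the identity. -/
theorem mulChart_conjChart (y : EuclideanSpace ℝ (Fin n)) :
    ∀ᶠ z in 𝓝 (chartOne n G 1), mulChart n G y z = mulChart n G (conjChart n G y z) y := by
  have hc : ContinuousAt (fun z => (chartOne n G).symm y * (chartOne n G).symm z *
      ((chartOne n G).symm y)⁻¹) (chartOne n G 1) := by
    have h1 := (contMDiffAt_chartOne_symm (mem_chartOne_target (n := n) (G := G))).continuousAt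
    have := topologicalGroup_of_lieGroup (𝓡 n) ∞ (G := G)
    fun_prop
  have hs : (chartOne n G).source ∈ 𝓝 ((chartOne n G).symm y *
      (chartOne n G).symm (chartOne n G 1) * ((chartOne n G).symm y)⁻¹) := by
    rw [chartOne_symm_self, mul_one, mul_inv_cancel]
    exact extChartAt_source_mem_nhds (I := 𝓡 n) (1 : G)
  filter_upwards [hc hs] with z hz
  rw [mulChart, mulChart, conjChart, (chartOne n G).left_inv hz, inv_mul_cancel_right]

/-- The derivative of the adjoint representation at the identity is the bracket of left-invariant
fields. In the chart at the identity, `y * z = (y z y⁻¹) * y` expresses the left-invariant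
fields by `Ad` and the right-invariant fields, and the second derivative of the multiplication is
symmetric. -/
theorem fderiv_adjointChart_eq_lieBracket (v w : EuclideanSpace ℝ (Fin n)) :
    fderiv ℝ (adjointChart n G) (chartOne n G 1) v w =
      lieBracket ℝ (fun y => fderiv ℝ (mulChart n G y) (chartOne n G 1) v)
        (fun y => fderiv ℝ (mulChart n G y) (chartOne n G 1) w) (chartOne n G 1) := by
  set o := chartOne n G 1 with ho
  set M := Function.uncurry (mulChart n G) with hM
  have hM2 : ContDiffAt ℝ 2 M (o, o) := contDiffAt_infty.1 contDiffAt_mulChart 2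
  have hC2 : ContDiffAt ℝ 2 (Function.uncurry (conjChart n G)) (o, o) :=
    contDiffAt_infty.1 contDiffAt_conjChart 2
  have hyo : Tendsto (fun y : EuclideanSpace ℝ (Fin n) => (y, o)) (𝓝 o) (𝓝 (o, o)) :=
    Continuous.tendsto' (by fun_prop) _ _ rfl
  have hoy : Tendsto (fun y : EuclideanSpace ℝ (Fin n) => (o, y)) (𝓝 o) (𝓝 (o, o)) :=
    Continuous.tendsto' (by fun_prop) _ _ rfl
  have hMev := hM2.eventually (by simp)
  have hCev := hC2.eventually (by simp)
  -- the left-invariant fields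
  have hleft : ∀ u : EuclideanSpace ℝ (Fin n), ∀ᶠ y in 𝓝 o,
      fderiv ℝ (mulChart n G y) o u = fderiv ℝ M (y, o) (0, u) := by
    intro u
    filter_upwards [hyo.eventually hMev] with y hy
    have h1 : HasFDerivAt (mulChart n G y) ((fderiv ℝ M (y, o)).comp
        (ContinuousLinearMap.inr ℝ _ _)) o :=
      (hy.differentiableAt (by simp)).hasFDerivAt.comp o (hasFDerivAt_prodMk_right y o)
    rw [h1.fderiv]
    rfl
  -- the left-invariant fields in terms of the right-invariant ones
  have hright : ∀ u : EuclideanSpace ℝ (Fin n), ∀ᶠ y in 𝓝 o,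
      fderiv ℝ M (y, o) (0, u) = fderiv ℝ M (o, y) (adjointChart n G y u, 0) := by
    intro u
    filter_upwards [hoy.eventually hMev, hyo.eventually hCev, hleft u] with y hy hy' hl
    rw [← hl, Filter.EventuallyEq.fderiv_eq (mulChart_conjChart y)]
    have h1 : HasFDerivAt (conjChart n G y) (adjointChart n G y) o := by
      rw [adjointChart_eq_fderiv]
      refine DifferentiableAt.hasFDerivAt ?_
      exact (hy'.differentiableAt (by simp)).comp o
        (hasFDerivAt_prodMk_right y o).differentiableAt
    have h2 : HasFDerivAt (fun z => (conjChart n G y z, y))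
      ((adjointChart n G y).prod 0) o := h1.prodMk (hasFDerivAt_const y o)
    have h3 : HasFDerivAt M (fderiv ℝ M (o, y)) (conjChart n G y o, y) := by
      rw [conjChart_one_right]
      exact (hy.differentiableAt (by simp)).hasFDerivAt
    exact DFunLike.congr_fun (HasFDerivAt.comp (g := M) o h3 h2).fderiv u
  -- both brackets are expressed by the second derivative `D2` of the multiplication
  obtain ⟨D2, hD2⟩ : ∃ D2, HasFDerivAt (fderiv ℝ M) D2 (o, o) :=
    ⟨_, ((hM2.fderiv_right (m := 1) (by norm_num)).differentiableAt (by simp)).hasFDerivAt⟩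
  have hsymm : ∀ p q, D2 p q = D2 q p := by
    have := hM2.isSymmSndFDerivAt (by simp)
    intro p q
    rw [← hD2.fderiv]
    exact this p q
  have hder : ∀ u, HasFDerivAt (fun y => fderiv ℝ M (y, o) (0, u))
      ((D2.comp (ContinuousLinearMap.inl ℝ _ _)).flip (0, u)) o := by
    intro u
    have h1 : HasFDerivAt (fun y => fderiv ℝ M (y, o))
        (D2.comp (ContinuousLinearMap.inl ℝ _ _)) o :=
      HasFDerivAt.comp (f := fun y => (y, o)) o hD2 (hasFDerivAt_prodMk_left o o)
    simpa using! h1.clm_apply (hasFDerivAt_const (0, u) o)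
  have hfield : ∀ u : EuclideanSpace ℝ (Fin n),
      fderiv ℝ (mulChart n G o) o u = u := by
    intro u
    have : mulChart n G o =ᶠ[𝓝 o] id := by
      filter_upwards [chartOne_target_mem_nhds (n := n) (G := G)] with y hy
      exact mulChart_one_left hy
    rw [this.fderiv_eq, fderiv_id]
    rfl
  have hfield' : ∀ u : EuclideanSpace ℝ (Fin n), fderiv ℝ M (o, o) (u, 0) = u := by
    intro u
    have h0 : (fun y => M (y, o)) =ᶠ[𝓝 o] id := by
      filter_upwards [chartOne_target_mem_nhds (n := n) (G := G)] with y hy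
      exact mulChart_one_right hy
    have h1 : HasFDerivAt (fun y => M (y, o)) ((fderiv ℝ M (o, o)).comp
        (ContinuousLinearMap.inl ℝ _ _)) o :=
      HasFDerivAt.comp (f := fun y => (y, o)) o (hM2.differentiableAt (by simp)).hasFDerivAt
        (hasFDerivAt_prodMk_left o o)
    have h2 := h1.fderiv
    rw [h0.fderiv_eq, fderiv_id] at h2
    exact (DFunLike.congr_fun h2 u).symm
  have hA : HasFDerivAt (adjointChart n G) (fderiv ℝ (adjointChart n G) o) o :=
    (contDiffAt_adjointChart.differentiableAt (by simp)).hasFDerivAt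
  have hD2r : HasFDerivAt (fun y => fderiv ℝ M (o, y))
      (D2.comp (ContinuousLinearMap.inr ℝ _ _)) o :=
    hD2.comp o (hasFDerivAt_prodMk_right o o)
  have hder' := hD2r.clm_apply
    ((hA.clm_apply (hasFDerivAt_const (w : EuclideanSpace ℝ (Fin n)) o)).prodMk
      (hasFDerivAt_const (0 : EuclideanSpace ℝ (Fin n)) o))
  have hA1 : adjointChart n G o w = w := by rw [adjointChart_one]; rfl
  have hkey : D2 (v, 0) (0, w) = fderiv ℝ (adjointChart n G) o v w + D2 (0, v) (w, 0) := by
    have h1 := DFunLike.congr_fun ((hder w).unique (hder'.congr_of_eventuallyEq (hright w))) v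
    rw [hA1] at h1
    refine h1.trans ?_
    have h2 := hfield' (fderiv ℝ (adjointChart n G) o v w)
    have h3 : (adjointChart n G o ∘SL
        (0 : EuclideanSpace ℝ (Fin n) →L[ℝ] EuclideanSpace ℝ (Fin n)) +
          (fderiv ℝ (adjointChart n G) o).flip w).prod
        (0 : EuclideanSpace ℝ (Fin n) →L[ℝ] EuclideanSpace ℝ (Fin n)) v =
        (fderiv ℝ (adjointChart n G) o v w, 0) := by simp
    exact congrArg (· + D2 (0, v) (w, 0)) ((congrArg (fderiv ℝ M (o, o)) h3).trans h2)
  have hl : ∀ u : EuclideanSpace ℝ (Fin n), (fun y => fderiv ℝ (mulChart n G y) o u) =ᶠ[𝓝 o]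
      fun y => fderiv ℝ M (y, o) (0, u) := hleft
  have hl' : ∀ u z : EuclideanSpace ℝ (Fin n),
      fderiv ℝ (fun y => fderiv ℝ (mulChart n G y) o u) o z = D2 (z, 0) (0, u) := by
    intro u z
    rw [(hl u).fderiv_eq, (hder u).fderiv]
    rfl
  have hgoal : lieBracket ℝ (fun y => fderiv ℝ (mulChart n G y) o v)
      (fun y => fderiv ℝ (mulChart n G y) o w) o = D2 (v, 0) (0, w) - D2 (w, 0) (0, v) := by
    rw [lieBracket, hfield, hfield, hl', hl']
  rw [hgoal, hkey, hsymm (w, 0), add_sub_cancel_right]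

/-- The derivative of `Ad` at the identity is `ad`. -/
theorem fderiv_adjointChart (v w : GroupLieAlgebra (𝓡 n) G) :
    (fderiv ℝ (adjointChart n G) (chartOne n G 1) v w : EuclideanSpace ℝ (Fin n)) =
      (⁅v, w⁆ : GroupLieAlgebra (𝓡 n) G) :=
  (fderiv_adjointChart_eq_lieBracket v w).trans (bracket_chart v w).symm

end ChartOne

/-! ### Curves in the group and their action on the Lie algebra -/

section GroupCurve

open Set Filter

theorem hasDerivAt_bilinForm {E : Type*} [NormedAddCommGroup E] [NormedSpace ℝ E]
    [FiniteDimensional ℝ E] (B : LinearMap.BilinForm ℝ E) {p q : ℝ → E} {P Q : E} {t : ℝ}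
    (hp : HasDerivAt p P t) (hq : HasDerivAt q Q t) :
    HasDerivAt (fun s => B (p s) (q s)) (B P (q t) + B (p t) Q) t :=
  ((LinearMap.toContinuousBilinearMap B).hasFDerivAt.comp_hasDerivAt t hp).clm_apply hq

theorem hasDerivAt_add_smul_zero {E : Type*} [NormedAddCommGroup E] [NormedSpace ℝ E] (x v : E) :
    HasDerivAt (fun s : ℝ => x + s • v) v 0 := by
  simpa using! ((hasDerivAt_id (0 : ℝ)).smul_const v).const_add x

theorem exists_hasDerivAt_zero {E : Type*} [NormedAddCommGroup E] [NormedSpace ℝ E] (x v : E) :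
    ∃ y : ℝ → E, y 0 = x ∧ HasDerivAt y v 0 :=
  ⟨fun s => x + s • v, by simp, hasDerivAt_add_smul_zero x v⟩

theorem hasDerivAt_iff_fst_snd {E F : Type*} [NormedAddCommGroup E] [NormedSpace ℝ E]
    [NormedAddCommGroup F] [NormedSpace ℝ F] {γ : ℝ → E × F} {Y : E × F} {t : ℝ} :
    HasDerivAt γ Y t ↔ HasDerivAt (fun s => (γ s).1) Y.1 t ∧ HasDerivAt (fun s => (γ s).2) Y.2 t :=
  ⟨fun h => ⟨(ContinuousLinearMap.fst ℝ E F).hasFDerivAt.comp_hasDerivAt t h,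
    (ContinuousLinearMap.snd ℝ E F).hasFDerivAt.comp_hasDerivAt t h⟩, fun h => h.1.prodMk h.2⟩

variable {n : ℕ} {G : Type*} [TopologicalSpace G] [ChartedSpace (EuclideanSpace ℝ (Fin n)) G]
  [Group G]

instance instFiniteDimensionalGroupLieAlgebra : FiniteDimensional ℝ (GroupLieAlgebra (𝓡 n) G) :=
  inferInstanceAs (FiniteDimensional ℝ (EuclideanSpace ℝ (Fin n)))

/-- `Ad g` as an operator on the model space of `G`, where the operator norm is available. -/
def adOp (g : G) : EuclideanSpace ℝ (Fin n) →L[ℝ] EuclideanSpace ℝ (Fin n) :=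
  Ad g

/-- `g` is a curve in `G` through the identity at time `0` whose action on the Lie algebra has the
derivative `D` there. -/
structure IsAdCurve (g : ℝ → G) (D : EuclideanSpace ℝ (Fin n) →L[ℝ] EuclideanSpace ℝ (Fin n)) :
    Prop where
  base : g 0 = 1
  deriv : HasDerivAt (fun s => adOp (n := n) (g s)) D 0

theorem adOp_one : adOp (n := n) (1 : G) = 1 := by
  ext1 v
  exact Ad_one v

theorem IsAdCurve.hasDerivAt_apply {g : ℝ → G}
    {D : EuclideanSpace ℝ (Fin n) →L[ℝ] EuclideanSpace ℝ (Fin n)} (hg : IsAdCurve g D)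
    {p : ℝ → EuclideanSpace ℝ (Fin n)} {P : EuclideanSpace ℝ (Fin n)} (hp : HasDerivAt p P 0) :
    HasDerivAt (fun s => adOp (g s) (p s)) (D (p 0) + P) 0 := by
  have h := hg.deriv.clm_apply hp
  rw [hg.base, adOp_one] at h
  exact h

variable (G) in
/-- The adjoint representation of the Lie algebra, as a continuous operator. -/
def adCLM (ξ : EuclideanSpace ℝ (Fin n)) :
    EuclideanSpace ℝ (Fin n) →L[ℝ] EuclideanSpace ℝ (Fin n) :=
  fderiv ℝ (adjointChart n G) (chartOne n G 1) ξ

variable (G) in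
theorem continuous_adCLM : Continuous (adCLM (n := n) G) :=
  (fderiv ℝ (adjointChart n G) (chartOne n G 1)).continuous

/-- `g` is a curve in `G` through the identity at time `0` whose adjoint action has the derivative
`ad ξ` there, as for a curve with velocity `ξ`. Only this consequence of having the velocity `ξ` is
recorded: it determines `ξ` up to the centre, and it is stable under products and inverses. -/
def IsGroupCurve (g : ℝ → G) (ξ : GroupLieAlgebra (𝓡 n) G) : Prop :=
  IsAdCurve g (adCLM G ξ)

theorem IsGroupCurve.base {g : ℝ → G} {ξ : GroupLieAlgebra (𝓡 n) G} (hg : IsGroupCurve g ξ) :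
    g 0 = 1 :=
  IsAdCurve.base hg

variable [LieGroup (𝓡 n) ∞ G]

theorem adOp_mul (g h : G) : adOp (n := n) (g * h) = adOp g * adOp h := by
  ext1 v
  exact Ad_mul g h v

theorem Ad_Ad_inv (g : G) (v : GroupLieAlgebra (𝓡 n) G) : Ad g (Ad g⁻¹ v) = v := by
  rw [← Ad_mul, mul_inv_cancel, Ad_one]

theorem adCLM_apply (ξ v : GroupLieAlgebra (𝓡 n) G) :
    (adCLM G (ξ : EuclideanSpace ℝ (Fin n)) (v : EuclideanSpace ℝ (Fin n)) :
      EuclideanSpace ℝ (Fin n)) = (⁅ξ, v⁆ : GroupLieAlgebra (𝓡 n) G) :=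
  fderiv_adjointChart ξ v

theorem hasStrictFDerivAt_adjointChart :
    HasStrictFDerivAt (adjointChart n G) (fderiv ℝ (adjointChart n G) (chartOne n G 1))
      (chartOne n G 1) :=
  contDiffAt_adjointChart.hasStrictFDerivAt (by simp)

theorem isAdCurve_chartOne {y : ℝ → EuclideanSpace ℝ (Fin n)} {ξ : EuclideanSpace ℝ (Fin n)}
    (hy0 : y 0 = chartOne n G 1) (hy : HasDerivAt y ξ 0) :
    IsAdCurve (fun s => (chartOne n G).symm (y s)) (adCLM G ξ) where
  base := by rw [hy0, chartOne_symm_self]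
  deriv := by
    have h := (hasStrictFDerivAt_adjointChart (n := n) (G := G)).hasFDerivAt
    rw [← hy0] at h
    have h2 := h.comp_hasDerivAt (0 : ℝ) hy
    rw [hy0] at h2
    exact h2


theorem exists_isAdCurve (ξ : EuclideanSpace ℝ (Fin n)) :
    ∃ g : ℝ → G, IsAdCurve g (adCLM G ξ) := by
  obtain ⟨y, hy0, hy⟩ := exists_hasDerivAt_zero (chartOne n G 1) ξ
  exact ⟨_, isAdCurve_chartOne hy0 hy⟩

theorem IsAdCurve.mul {g h : ℝ → G}
    {D F : EuclideanSpace ℝ (Fin n) →L[ℝ] EuclideanSpace ℝ (Fin n)}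
    (hg : IsAdCurve g D) (hh : IsAdCurve h F) : IsAdCurve (fun s => g s * h s) (D + F) where
  base := by rw [hg.base, hh.base, mul_one]
  deriv := by
    have h1 := hg.deriv.mul hh.deriv
    rw [hg.base, hh.base, adOp_one, one_mul, mul_one] at h1
    exact h1.congr_of_eventuallyEq (Eventually.of_forall fun s => adOp_mul _ _)

theorem IsAdCurve.inv {g : ℝ → G} {D : EuclideanSpace ℝ (Fin n) →L[ℝ] EuclideanSpace ℝ (Fin n)}
    (hg : IsAdCurve g D) : IsAdCurve (fun s => (g s)⁻¹) (-D) where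
  base := by rw [hg.base, inv_one]
  deriv := by
    have h1 := hasFDerivAt_ringInverse (𝕜 := ℝ) (1 : (EuclideanSpace ℝ (Fin n) →L[ℝ]
        EuclideanSpace ℝ (Fin n))ˣ)
    have h0 : adOp (g 0) = ((1 : (EuclideanSpace ℝ (Fin n) →L[ℝ] EuclideanSpace ℝ (Fin n))ˣ) :
        EuclideanSpace ℝ (Fin n) →L[ℝ] EuclideanSpace ℝ (Fin n)) := by
      rw [hg.base, adOp_one, Units.val_one]
    rw [← h0] at h1
    have h2 := h1.comp_hasDerivAt (0 : ℝ) hg.deriv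
    have h3 : ∀ s, adOp (n := n) (g s)⁻¹ = Ring.inverse (adOp (g s)) := by
      intro s
      refine (Ring.inverse_unit ⟨adOp (g s), adOp (g s)⁻¹, ?_, ?_⟩).symm
      · rw [← adOp_mul, mul_inv_cancel, adOp_one]
      · rw [← adOp_mul, inv_mul_cancel, adOp_one]
    have h4 := h2.congr_of_eventuallyEq (Eventually.of_forall h3)
    simpa using! h4

theorem exists_isGroupCurve (ξ : GroupLieAlgebra (𝓡 n) G) : ∃ g : ℝ → G, IsGroupCurve g ξ :=
  exists_isAdCurve ξ

theorem IsGroupCurve.mul {g h : ℝ → G} {ξ η : GroupLieAlgebra (𝓡 n) G}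
    (hg : IsGroupCurve g ξ) (hh : IsGroupCurve h η) :
    IsGroupCurve (fun s => g s * h s) (ξ + η) := by
  have h1 : adCLM (n := n) G (ξ + η : GroupLieAlgebra (𝓡 n) G) = adCLM G ξ + adCLM G η :=
    map_add (fderiv ℝ (adjointChart n G) (chartOne n G 1)) ξ η
  have h2 := IsAdCurve.mul hg hh
  rw [← h1] at h2
  exact h2

theorem IsGroupCurve.inv {g : ℝ → G} {ξ : GroupLieAlgebra (𝓡 n) G}
    (hg : IsGroupCurve g ξ) : IsGroupCurve (fun s => (g s)⁻¹) (-ξ) := by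
  have h1 : adCLM (n := n) G (-ξ : GroupLieAlgebra (𝓡 n) G) = -adCLM G ξ :=
    map_neg (fderiv ℝ (adjointChart n G) (chartOne n G 1)) ξ
  have h2 := IsAdCurve.inv hg
  rw [← h1] at h2
  exact h2

theorem IsGroupCurve.hasDerivAt_apply {g : ℝ → G} {ξ : GroupLieAlgebra (𝓡 n) G}
    (hg : IsGroupCurve g ξ) {p : ℝ → GroupLieAlgebra (𝓡 n) G} {P : GroupLieAlgebra (𝓡 n) G}
    (hp : HasDerivAt p P 0) : HasDerivAt (fun s => Ad (g s) (p s)) (⁅ξ, p 0⁆ + P) 0 := by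
  have h := IsAdCurve.hasDerivAt_apply hg (p := p) (P := P) hp
  have h1 := adCLM_apply ξ (p 0)
  exact h1 ▸ h

theorem IsGroupCurve.hasDerivAt_const {g : ℝ → G} {ξ : GroupLieAlgebra (𝓡 n) G}
    (hg : IsGroupCurve g ξ) (v : GroupLieAlgebra (𝓡 n) G) :
    HasDerivAt (fun s => Ad (g s) v) ⁅ξ, v⁆ 0 := by
  have h := hg.hasDerivAt_apply (p := fun _ => v) (P := 0)
    (_root_.hasDerivAt_const (F := EuclideanSpace ℝ (Fin n)) 0 v)
  rwa [add_zero] at h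

theorem hasFDerivAt_conj_chart (g : G) :
    HasFDerivAt (fun z => chartOne n G (g * (chartOne n G).symm z * g⁻¹))
      (Ad g : EuclideanSpace ℝ (Fin n) →L[ℝ] EuclideanSpace ℝ (Fin n)) (chartOne n G 1) := by
  rw [Ad_eq_fderiv]
  refine DifferentiableAt.hasFDerivAt ?_
  refine MDifferentiableAt.differentiableAt (ContMDiffAt.mdifferentiableAt (n := ∞) ?_ (by simp))
  refine ContMDiffAt.comp _ (contMDiffAt_chartOne ?_)
    ((contMDiffAt_const.mul (contMDiffAt_chartOne_symm mem_chartOne_target)).mul contMDiffAt_const)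
  simpa only [chartOne_symm_self, mul_one, mul_inv_cancel] using mem_chartOne_source

theorem differentiableAt_mul_left_chart {y : EuclideanSpace ℝ (Fin n)}
    (hy : y ∈ (chartOne n G).target) :
    DifferentiableAt ℝ (fun z => chartOne n G (((chartOne n G).symm y)⁻¹ * (chartOne n G).symm z))
      y := by
  refine MDifferentiableAt.differentiableAt (ContMDiffAt.mdifferentiableAt (n := ∞) ?_ (by simp))
  refine ContMDiffAt.comp _ (contMDiffAt_chartOne ?_)
    (contMDiffAt_const.mul (contMDiffAt_chartOne_symm hy))
  simpa only [inv_mul_cancel] using mem_chartOne_source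

/-- The adjoint action is by automorphisms of the Lie algebra: differentiate
`Ad g ∘ Ad (y s) = Ad (g (y s) g⁻¹) ∘ Ad g` along a curve `y` with velocity `v`. -/
theorem Ad_lie (g : G) (v w : GroupLieAlgebra (𝓡 n) G) : Ad g ⁅v, w⁆ = ⁅Ad g v, Ad g w⁆ := by
  obtain ⟨y, hy0, hy⟩ : ∃ y : ℝ → EuclideanSpace ℝ (Fin n), y 0 = chartOne n G 1 ∧
      HasDerivAt y (v : EuclideanSpace ℝ (Fin n)) 0 :=
    exists_hasDerivAt_zero _ _
  have hcurve : IsGroupCurve (fun s => (chartOne n G).symm (y s)) v := isAdCurve_chartOne hy0 hy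
  -- the conjugate curve, read in the chart
  have hz : HasDerivAt (fun s => chartOne n G (g * (chartOne n G).symm (y s) * g⁻¹))
      (Ad g v : EuclideanSpace ℝ (Fin n)) 0 := by
    have h := hasFDerivAt_conj_chart (n := n) g
    rw [← hy0] at h
    exact h.comp_hasDerivAt (0 : ℝ) hy
  have hconj : IsGroupCurve
      (fun s => (chartOne n G).symm (chartOne n G (g * (chartOne n G).symm (y s) * g⁻¹)))
      (Ad g v) :=
    isAdCurve_chartOne (by rw [hy0, chartOne_symm_self, mul_one, mul_inv_cancel]) hz
  have hs : ∀ᶠ s in 𝓝 (0 : ℝ), g * (chartOne n G).symm (y s) * g⁻¹ ∈ (chartOne n G).source := by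
    have hc : ContinuousAt (fun s => g * (chartOne n G).symm (y s) * g⁻¹) 0 := by
      have h1 := (contMDiffAt_chartOne_symm (mem_chartOne_target (n := n) (G := G))).continuousAt
      rw [← hy0] at h1
      have h2 : ContinuousAt (fun s => (chartOne n G).symm (y s)) 0 :=
        ContinuousAt.comp h1 hy.continuousAt
      have := topologicalGroup_of_lieGroup (𝓡 n) ∞ (G := G)
      fun_prop
    refine hc ?_
    show (chartOne n G).source ∈ 𝓝 (g * (chartOne n G).symm (y 0) * g⁻¹)
    rw [hy0, chartOne_symm_self, mul_one, mul_inv_cancel]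
    exact extChartAt_source_mem_nhds (I := 𝓡 n) (1 : G)
  have h1 := hconj.hasDerivAt_const (Ad g w)
  have h2 : HasDerivAt (fun s => Ad g (Ad ((chartOne n G).symm (y s)) w)) (Ad g ⁅v, w⁆) 0 :=
    (adOp (n := n) g).hasFDerivAt.comp_hasDerivAt (0 : ℝ) (hcurve.hasDerivAt_const w)
  have h3 : (fun s => Ad g (Ad ((chartOne n G).symm (y s)) w)) =ᶠ[𝓝 0] fun s => Ad
      ((chartOne n G).symm (chartOne n G (g * (chartOne n G).symm (y s) * g⁻¹))) (Ad g w) := by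
    filter_upwards [hs] with s hs
    rw [(chartOne n G).left_inv hs, ← Ad_mul, ← Ad_mul, inv_mul_cancel_right]
  exact HasDerivAt.unique (F := EuclideanSpace ℝ (Fin n)) h2 (h1.congr_of_eventuallyEq h3)

theorem hasFDerivAt_clm_apply_zero {E F : Type*} [NormedAddCommGroup E] [NormedSpace ℝ E]
    [NormedAddCommGroup F] [NormedSpace ℝ F] {f : E → F →L[ℝ] F} {f' : E →L[ℝ] F →L[ℝ] F} {x : E}
    (hf : HasFDerivAt f f' x) {c : F} (hc : ∀ u, f' u c = 0) (A : F →L[ℝ] F) :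
    HasFDerivAt (fun z => A (f z c)) (0 : E →L[ℝ] F) x := by
  refine (A.hasFDerivAt.comp x (hf.clm_apply (hasFDerivAt_const c x))).congr_fderiv ?_
  ext u
  simp [hc]

/-- A central element of the Lie algebra is fixed by the adjoint action of a connected group: the
derivative of `g ↦ Ad g c` vanishes near the identity, so that the stabilizer of `c` is open. -/
theorem Ad_eq_self_of_central [ConnectedSpace G] {c : GroupLieAlgebra (𝓡 n) G}
    (hc : ∀ ξ : GroupLieAlgebra (𝓡 n) G, ⁅ξ, c⁆ = 0) (g : G) : Ad g c = c := by
  set o := chartOne n G 1 with ho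
  have hzero : ∀ y ∈ (chartOne n G).target,
      HasFDerivAt (fun z => adjointChart n G z (c : EuclideanSpace ℝ (Fin n)))
        (0 : EuclideanSpace ℝ (Fin n) →L[ℝ] EuclideanSpace ℝ (Fin n)) y := by
    intro y hy
    set k := (chartOne n G).symm y with hk
    have h1 := (differentiableAt_mul_left_chart hy).hasFDerivAt
    rw [← hk] at h1
    have h2 : HasFDerivAt (adjointChart n G) (fderiv ℝ (adjointChart n G) o)
        (chartOne n G (k⁻¹ * k)) := by
      rw [inv_mul_cancel]
      exact hasStrictFDerivAt_adjointChart.hasFDerivAt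
    have h6 : ∀ ξ : EuclideanSpace ℝ (Fin n),
        fderiv ℝ (adjointChart n G) o ξ (c : EuclideanSpace ℝ (Fin n)) = 0 :=
      fun ξ => (fderiv_adjointChart ξ c).trans (hc ξ)
    have h3 := hasFDerivAt_clm_apply_zero (HasFDerivAt.comp (g := adjointChart n G)
      (f := fun z => chartOne n G (k⁻¹ * (chartOne n G).symm z)) y h2 h1)
        (fun u => h6 _) (adOp (n := n) k)
    have h4 : (fun z => adjointChart n G z (c : EuclideanSpace ℝ (Fin n))) =ᶠ[𝓝 y]
        fun z => adOp (n := n) k (adjointChart n G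
          (chartOne n G (k⁻¹ * (chartOne n G).symm z)) c) := by
      have hcont : ContinuousAt (fun z => k⁻¹ * (chartOne n G).symm z) y := by
        have h1 := (contMDiffAt_chartOne_symm hy).continuousAt
        have := topologicalGroup_of_lieGroup (𝓡 n) ∞ (G := G)
        fun_prop
      have hs : (chartOne n G).source ∈ 𝓝 (k⁻¹ * (chartOne n G).symm y) := by
        rw [← hk, inv_mul_cancel]
        exact extChartAt_source_mem_nhds (I := 𝓡 n) (1 : G)
      filter_upwards [hcont hs] with z hz
      have h5 : adjointChart n G (chartOne n G (k⁻¹ * (chartOne n G).symm z)) =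
          adOp (k⁻¹ * (chartOne n G).symm z) := by
        rw [adjointChart, (chartOne n G).left_inv hz]
        rfl
      rw [h5, adOp_mul]
      exact (Ad_Ad_inv k _).symm
    exact h3.congr_of_eventuallyEq h4
  have hconst : ∀ᶠ y in 𝓝 o, adjointChart n G y (c : EuclideanSpace ℝ (Fin n)) = c := by
    obtain ⟨r, hr, hball⟩ := Metric.mem_nhds_iff.1 (chartOne_target_mem_nhds (n := n) (G := G))
    filter_upwards [Metric.ball_mem_nhds o hr] with y hy
    have h1 := (convex_ball o r).is_const_of_fderivWithin_eq_zero (𝕜 := ℝ)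
      (f := fun z => adjointChart n G z (c : EuclideanSpace ℝ (Fin n)))
      (fun z hz => (hzero z (hball hz)).differentiableAt.differentiableWithinAt)
      (fun z hz => (hzero z (hball hz)).hasFDerivWithinAt.fderivWithin
        (Metric.isOpen_ball.uniqueDiffWithinAt hz)) hy (Metric.mem_ball_self hr)
    rw [h1, adjointChart_one]
    rfl
  let S : Subgroup G :=
    { carrier := {g | Ad g c = c}
      mul_mem' := fun {g h} hg hh => by
        have hg' : Ad g c = c := hg
        have hh' : Ad h c = c := hh
        show Ad (g * h) c = c
        rw [Ad_mul, hh', hg']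
      one_mem' := Ad_one c
      inv_mem' := fun {g} hg => by
        have hg' : Ad g c = c := hg
        show Ad g⁻¹ c = c
        conv_lhs => rw [← hg']
        exact Ad_inv_Ad g c }
  have := topologicalGroup_of_lieGroup (𝓡 n) ∞ (G := G)
  have hopen : IsOpen (S : Set G) := by
    refine S.isOpen_of_mem_nhds (g := 1) ?_
    have h1 : ContinuousAt (chartOne n G) 1 := continuousAt_extChartAt (I := 𝓡 n) (1 : G)
    filter_upwards [h1 hconst, extChartAt_source_mem_nhds (I := 𝓡 n) (1 : G)] with g hg hgs
    have h2 : adjointChart n G (chartOne n G g) (c : EuclideanSpace ℝ (Fin n)) = c := hg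
    rw [adjointChart, (chartOne n G).left_inv hgs] at h2
    exact h2
  have huniv : (S : Set G) = univ :=
    IsClopen.eq_univ ⟨S.isClosed_of_isOpen hopen, hopen⟩ ⟨1, S.one_mem⟩
  have hg : g ∈ (S : Set G) := huniv ▸ mem_univ g
  exact hg

end GroupCurve

/-! ### Linear algebra of an ad-invariant scalar product -/

section AdInvariant

variable {L : Type*} [LieRing L] [LieAlgebra ℝ L]

/-- A scalar product on a Lie algebra for which the operators `ad ξ` are skew. -/
structure IsAdInvariant (B : LinearMap.BilinForm ℝ L) : Prop where
  symm : ∀ x y, B x y = B y x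
  pos : ∀ x, x ≠ 0 → 0 < B x x
  lie : ∀ ξ x y : L, B ⁅ξ, x⁆ y = -B x ⁅ξ, y⁆

variable {B : LinearMap.BilinForm ℝ L}

theorem mem_ann {x η : L} : η ∈ ann x ↔ ⁅η, x⁆ = 0 := Iff.rfl

namespace IsAdInvariant

variable (hB : IsAdInvariant B)
include hB

theorem eq_zero {x : L} (h : B x x = 0) : x = 0 := by
  by_contra hx
  exact (hB.pos x hx).ne' h

theorem ext_left {x y : L} (h : ∀ ξ, B x ξ = B y ξ) : x = y := by
  rw [← sub_eq_zero]
  refine hB.eq_zero ?_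
  rw [LinearMap.map_sub₂, h, sub_self]

/-- The associativity of an ad-invariant scalar product. -/
theorem lie' (x y z : L) : B ⁅x, y⁆ z = B x ⁅y, z⁆ := by
  rw [← lie_skew, LinearMap.map_neg₂, hB.lie, neg_neg]

theorem inner_lie_right (x w ξ : L) : B w ⁅ξ, x⁆ = B ⁅x, w⁆ ξ := by
  rw [hB.symm, hB.lie', hB.symm]

theorem lie_mem_annPerp (ξ x : L) : ⁅ξ, x⁆ ∈ annPerp B x := by
  intro η hη
  rw [mem_ann] at hη
  rw [← lie_skew, map_neg, ← hB.lie', hη, LinearMap.map_zero₂, neg_zero]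

theorem lie_mem_annPerp' (ξ x : L) : ⁅x, ξ⁆ ∈ annPerp B x := by
  rw [← lie_skew]
  exact Submodule.neg_mem _ (hB.lie_mem_annPerp ξ x)

theorem inner_annPerp_ann {x η y : L} (hη : ⁅η, x⁆ = 0) (hy : y ∈ annPerp B x) : B y η = 0 := by
  rw [hB.symm]
  exact hy η hη

theorem eq_zero_of_mem {x y : L} (h : y ∈ ann x) (h' : y ∈ annPerp B x) : y = 0 :=
  hB.eq_zero (h' y h)

theorem mem_annPerp_of_lie_mem {x p η : L} (hp : p ∈ annPerp B x) (hη : ⁅η, x⁆ = 0) :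
    ⁅η, p⁆ ∈ annPerp B x := by
  intro ζ hζ
  rw [mem_ann] at hζ
  rw [← hB.lie']
  refine hp _ ?_
  rw [mem_ann, lie_lie, hη, hζ, lie_zero, lie_zero, sub_zero]

theorem mem_annPerp_of_lie_right {x y : L} (h : ∀ η, ⁅η, x⁆ = 0 → B y η = 0) :
    y ∈ annPerp B x := by
  intro η hη
  rw [hB.symm]
  exact h η hη

theorem lie_injOn {x u v : L} (hu : u ∈ annPerp B x) (hv : v ∈ annPerp B x)
    (h : ⁅u, x⁆ = ⁅v, x⁆) : u = v := by
  rw [← sub_eq_zero]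
  refine hB.eq_zero_of_mem (x := x) ?_ (Submodule.sub_mem _ hu hv)
  rw [mem_ann, sub_lie, h, sub_self]

theorem orthProj_ann_eq {x y u : L} (hu : u ∈ ann x) (h : y - u ∈ annPerp B x) :
    orthProj B (ann x) y = u := by
  have hex : ∃ w : L, w ∈ ann x ∧ y - w ∈ B.orthogonal (ann x) := ⟨u, hu, h⟩
  obtain ⟨h1, h2⟩ := Classical.epsilon_spec hex
  have h3 : orthProj B (ann x) y - u ∈ annPerp B x := by
    have := Submodule.sub_mem _ h h2
    rwa [sub_sub_sub_cancel_left] at this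
  exact sub_eq_zero.1 (hB.eq_zero_of_mem (Submodule.sub_mem _ h1 hu) h3)

variable [FiniteDimensional ℝ L]

theorem isCompl (x : L) : IsCompl (ann x) (annPerp B x) :=
  isCompl_orthogonal_of_pos hB.symm hB.pos _

theorem exists_add (x y : L) : ∃ u ∈ ann x, ∃ v ∈ annPerp B x, u + v = y :=
  Submodule.mem_sup.1 ((hB.isCompl x).sup_eq_top ▸ Submodule.mem_top)

/-- `ad x` restricts to an injective, hence bijective, endomorphism of `ann(x)^⊥`. -/
theorem exists_lie_eq {x y : L} (hy : y ∈ annPerp B x) : ∃ ξ ∈ annPerp B x, ⁅ξ, x⁆ = y := by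
  let f : annPerp B x →ₗ[ℝ] annPerp B x :=
    { toFun := fun ξ => ⟨⁅(ξ : L), x⁆, hB.lie_mem_annPerp _ _⟩
      map_add' := fun u v => by ext; simp
      map_smul' := fun c u => by ext; simp }
  have hf : Function.Injective f := by
    rw [injective_iff_map_eq_zero]
    intro u hu
    have h1 : ⁅(u : L), x⁆ = 0 := congrArg Subtype.val hu
    exact Subtype.ext (hB.eq_zero_of_mem h1 u.2)
  obtain ⟨ξ, hξ⟩ := LinearMap.injective_iff_surjective.1 hf ⟨y, hy⟩
  exact ⟨ξ, ξ.2, congrArg Subtype.val hξ⟩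

theorem orbitGen_spec {x y : L} (hy : y ∈ annPerp B x) :
    orbitGen B x y ∈ annPerp B x ∧ ⁅orbitGen B x y, x⁆ = y := by
  have h : ∃ ξ ∈ (annPerp B x : Set L), (fun ξ : L => ⁅ξ, x⁆) ξ = y := hB.exists_lie_eq hy
  exact ⟨Function.invFunOn_mem h, Function.invFunOn_eq h⟩

theorem orbitGen_eq {x ξ y : L} (hξ : ξ ∈ annPerp B x) (h : ⁅ξ, x⁆ = y) : orbitGen B x y = ξ := by
  have hy : y ∈ annPerp B x := h ▸ hB.lie_mem_annPerp ξ x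
  obtain ⟨h1, h2⟩ := hB.orbitGen_spec hy
  exact hB.lie_injOn h1 hξ (h2.trans h.symm)

theorem bijOn_lie (x : L) :
    Set.BijOn (fun ξ => ⁅x, ξ⁆) (annPerp B x : Set L) (annPerp B x : Set L) := by
  refine ⟨fun ξ _ => hB.lie_mem_annPerp' ξ x, fun u hu v hv h => ?_, fun y hy => ?_⟩
  · have h' : ⁅x, u⁆ = ⁅x, v⁆ := h
    rw [← lie_skew, ← lie_skew x v, neg_inj] at h'
    exact hB.lie_injOn hu hv h'
  · obtain ⟨ξ, hξ, h⟩ := hB.exists_lie_eq hy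
    refine ⟨-ξ, Submodule.neg_mem _ hξ, ?_⟩
    show ⁅x, -ξ⁆ = y
    rw [lie_neg, lie_skew, h]

theorem adInv_spec {x y : L} (hy : y ∈ annPerp B x) :
    adInv B x y ∈ annPerp B x ∧ ⁅x, adInv B x y⁆ = y := by
  have h : ∃ ξ ∈ (annPerp B x : Set L), (fun ξ : L => ⁅x, ξ⁆) ξ = y := (hB.bijOn_lie x).surjOn hy
  exact ⟨Function.invFunOn_mem h, Function.invFunOn_eq h⟩

theorem orthProj_ann_spec (x y : L) :
    orthProj B (ann x) y ∈ ann x ∧ y - orthProj B (ann x) y ∈ annPerp B x := by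
  obtain ⟨u, hu, v, hv, rfl⟩ := hB.exists_add x y
  rw [hB.orthProj_ann_eq hu (by rwa [add_sub_cancel_left]), add_sub_cancel_left]
  exact ⟨hu, hv⟩

/-- The Kirillov-Kostant form of `u ∈ ann(x)^⊥` and `[ξ, x]`. -/
theorem kirillovForm_lie {x u : L} (hu : u ∈ annPerp B x) (ξ : L) :
    kirillovForm B x u ⁅ξ, x⁆ = B u ξ := by
  obtain ⟨h1, h2⟩ := hB.orbitGen_spec hu
  obtain ⟨h3, h4⟩ := hB.orbitGen_spec (hB.lie_mem_annPerp ξ x)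
  set o := orbitGen B x u
  set o' := orbitGen B x ⁅ξ, x⁆
  have h5 : B u (o' - ξ) = 0 :=
    hB.inner_annPerp_ann (x := x) (by rw [sub_lie, h4, sub_self]) hu
  rw [map_sub, sub_eq_zero] at h5
  rw [kirillovForm, ← h5, ← hB.lie', ← lie_skew, h2, LinearMap.map_neg₂, neg_neg]

end IsAdInvariant

end AdInvariant

/-! ### Lifting curves through a submersion onto a slice -/

section Lift

open Filter

theorem HasStrictFDerivAt.clm_apply_const {E F : Type*} [NormedAddCommGroup E] [NormedSpace ℝ E]
    [NormedAddCommGroup F] [NormedSpace ℝ F] {f : E → F →L[ℝ] F} {f' : E →L[ℝ] F →L[ℝ] F} {x : E}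
    (hf : HasStrictFDerivAt f f' x) (c : F) :
    HasStrictFDerivAt (fun z => f z c) (f'.flip c) x := by
  refine (hf.clm_apply (hasStrictFDerivAt_const c x)).congr_fderiv ?_
  ext1 v
  simp

/-- The implicit function theorem for curves: if the derivative of `Φ` followed by the projection
`P` is injective on the range of `P`, then a curve through `Φ o` lifts to the slice `o + range P`,
up to the kernel of `P`. -/
theorem exists_lift_curve {E : Type*} [NormedAddCommGroup E] [NormedSpace ℝ E]
    [FiniteDimensional ℝ E] {Φ : E → E} {Φ' P : E →L[ℝ] E} {o : E}
    (hΦ : HasStrictFDerivAt Φ Φ' o) (hP : ∀ v, P (P v) = P v)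
    (hinj : ∀ v, P (Φ' (P v)) = 0 → P v = 0) {γ : ℝ → E} {Y : E} (h0 : γ 0 = Φ o)
    (hγ : HasDerivAt γ Y 0) :
    ∃ (y : ℝ → E) (η : E), y 0 = o ∧ HasDerivAt y (P η) 0 ∧ ∀ᶠ s in 𝓝 0, P (Φ (y s)) = P (γ s) := by
  have : CompleteSpace E := FiniteDimensional.complete ℝ E
  -- the derivative of `v ↦ P (Φ (o + P v)) + (v - P v)`, a local diffeomorphism of `E`
  let D : E →L[ℝ] E := P ∘L Φ' ∘L P + (ContinuousLinearMap.id ℝ E - P)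
  have hD : Function.Injective D := by
    rw [injective_iff_map_eq_zero]
    intro v hv
    have h1 : P (Φ' (P v)) + (v - P v) = 0 := hv
    have h2 := congrArg P h1
    rw [map_add, map_sub, hP, hP, sub_self, add_zero, map_zero] at h2
    have h3 := hinj v h2
    rwa [h2, h3, sub_zero, zero_add] at h1
  let e : E ≃L[ℝ] E :=
    (LinearEquiv.ofInjectiveEndo (D : E →ₗ[ℝ] E) hD).toContinuousLinearEquiv
  have he : (e : E →L[ℝ] E) = D := by
    ext v
    rfl
  have hΦ0 : HasStrictFDerivAt Φ Φ' (o + P 0) := by rwa [map_zero, add_zero]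
  have hΨ : HasStrictFDerivAt (fun v => P (Φ (o + P v)) + (v - P v)) (e : E →L[ℝ] E) 0 := by
    rw [he]
    have h1 : HasStrictFDerivAt (fun v => o + P v) P 0 := P.hasStrictFDerivAt.const_add o
    have h2 : HasStrictFDerivAt (fun v => Φ (o + P v)) (Φ' ∘L P) 0 := hΦ0.comp (0 : E) h1
    have h3 : HasStrictFDerivAt (fun v => P (Φ (o + P v))) (P ∘L Φ' ∘L P) 0 :=
      P.hasStrictFDerivAt.comp (0 : E) h2
    exact h3.add ((hasStrictFDerivAt_id (0 : E)).sub P.hasStrictFDerivAt)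
  have hΨ0 : P (Φ (o + P 0)) + (0 - P 0) = P (γ 0) := by
    rw [h0, map_zero, add_zero, sub_zero, add_zero]
  have hinv := hΨ.to_localInverse.hasFDerivAt
  have hright := hΨ.eventually_right_inverse
  have himg := hΨ.localInverse_apply_image
  set inv := hΨ.localInverse (fun v => P (Φ (o + P v)) + (v - P v)) e 0
  simp only [hΨ0] at hinv hright himg
  have hPγ : HasDerivAt (fun s => P (γ s)) (P Y) 0 := P.hasFDerivAt.comp_hasDerivAt (0 : ℝ) hγ
  have hv : HasDerivAt (fun s => inv (P (γ s))) _ 0 := hinv.comp_hasDerivAt (0 : ℝ) hPγ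
  refine ⟨fun s => o + P (inv (P (γ s))), _, ?_,
    (P.hasFDerivAt.comp_hasDerivAt (0 : ℝ) hv).const_add o, ?_⟩
  · show o + P (inv (P (γ 0))) = o
    rw [himg, map_zero, add_zero]
  · filter_upwards [hPγ.continuousAt.eventually hright] with s hs
    have h1 := congrArg P hs
    rwa [map_add, map_sub, hP, hP, hP, sub_self, add_zero] at h1

end Lift

/-! ### Adjoint orbits as embedded submanifolds -/

section Orbit

open Filter Polynomial

variable {n : ℕ} {G : Type*} [TopologicalSpace G] [ChartedSpace (EuclideanSpace ℝ (Fin n)) G]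
  [Group G]
  {B : LinearMap.BilinForm ℝ (GroupLieAlgebra (𝓡 n) G)} {a x : GroupLieAlgebra (𝓡 n) G}

theorem semiconjBy_aeval {R : Type*} [Ring R] [Algebra ℝ R] {u A A' : R} (h : SemiconjBy u A A')
    (q : ℝ[X]) : SemiconjBy u (aeval A q) (aeval A' q) := by
  induction q using Polynomial.induction_on' with
  | add p q hp hq => simpa using hp.add_right hq
  | monomial k c =>
    rw [aeval_monomial, aeval_monomial]
    exact SemiconjBy.mul_right (Algebra.commutes c u).symm (h.pow_right k)

theorem HasDerivAt.bilinForm {p q : ℝ → GroupLieAlgebra (𝓡 n) G} {P Q : GroupLieAlgebra (𝓡 n) G}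
    {t : ℝ} (hp : HasDerivAt p P t) (hq : HasDerivAt q Q t) :
    HasDerivAt (fun s => B (p s) (q s)) (B P (q t) + B (p t) Q) t :=
  hasDerivAt_bilinForm (E := EuclideanSpace ℝ (Fin n)) B hp hq

theorem adCLM_sub (u v : GroupLieAlgebra (𝓡 n) G) :
    adCLM (n := n) G (u - v : GroupLieAlgebra (𝓡 n) G) = adCLM G u - adCLM G v :=
  map_sub (fderiv ℝ (adjointChart n G) (chartOne n G 1)) u v

variable [LieGroup (𝓡 n) ∞ G]

theorem IsInvariantScalarProduct.isAdInvariant (hB : IsInvariantScalarProduct B) :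
    IsAdInvariant B where
  symm := hB.symm
  pos := hB.pos
  lie := by
    intro ξ x y
    obtain ⟨g, hg⟩ := exists_isGroupCurve ξ
    have h1 : HasDerivAt (fun s => B (Ad (g s) x) (Ad (g s) y)) _ 0 :=
      HasDerivAt.bilinForm (hg.hasDerivAt_const x) (hg.hasDerivAt_const y)
    have h2 : HasDerivAt (fun s => B (Ad (g s) x) (Ad (g s) y)) 0 0 := by
      simp only [hB.inv]
      exact hasDerivAt_const _ _
    have h3 := h1.unique h2
    rw [hg.base, Ad_one, Ad_one] at h3
    linarith

theorem adCLM_Ad (g : G) (ξ : GroupLieAlgebra (𝓡 n) G) :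
    SemiconjBy (adOp g) (adCLM G ξ) (adCLM G (Ad g ξ)) := by
  show adOp g * adCLM G ξ = adCLM G (Ad g ξ) * adOp g
  ext1 v
  have h1 : adOp g (adCLM G ξ v) = (Ad g ⁅ξ, (v : GroupLieAlgebra (𝓡 n) G)⁆ :) :=
    congrArg (adOp g) (adCLM_apply ξ v)
  have h2 : adCLM G (Ad g ξ) (adOp g v) = (⁅Ad g ξ, Ad g (v : GroupLieAlgebra (𝓡 n) G)⁆ :) :=
    adCLM_apply (Ad g ξ) (Ad g v)
  exact (h1.trans (Ad_lie g ξ v)).trans h2.symm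

theorem commute_adCLM {u v : GroupLieAlgebra (𝓡 n) G} (h : ⁅u, v⁆ = 0) :
    Commute (adCLM (n := n) G u) (adCLM G v) := by
  have key : ∀ w : GroupLieAlgebra (𝓡 n) G, adCLM G u (adCLM G v w) = adCLM G v (adCLM G u w) := by
    intro w
    have h1 : adCLM G u (adCLM G v w) = (⁅u, ⁅v, w⁆⁆ :) :=
      (congrArg (adCLM G u) (adCLM_apply v w)).trans (adCLM_apply u _)
    have h2 : adCLM G v (adCLM G u w) = (⁅v, ⁅u, w⁆⁆ :) :=
      (congrArg (adCLM G v) (adCLM_apply u w)).trans (adCLM_apply v _)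
    have h3 : ⁅u, ⁅v, w⁆⁆ = ⁅v, ⁅u, w⁆⁆ := by rw [leibniz_lie, h, zero_lie, zero_add]
    exact (h1.trans h3).trans h2.symm
  exact ContinuousLinearMap.ext key

/-- `ad x` is a root of a separable polynomial, in the Banach algebra of operators on the model
space. -/
theorem exists_separable_aeval_adCLM (hB : IsInvariantScalarProduct B)
    (x : GroupLieAlgebra (𝓡 n) G) :
    ∃ q : ℝ[X], IsCoprime q (derivative q) ∧ aeval (adCLM (n := n) G x) q = 0 := by
  let f : Module.End ℝ (GroupLieAlgebra (𝓡 n) G) := (adCLM (n := n) G x).toLinearMap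
  have hf : ∀ u : GroupLieAlgebra (𝓡 n) G, f u = ⁅x, u⁆ := fun u => adCLM_apply x u
  refine ⟨minpoly ℝ f, isCoprime_minpoly_derivative_of_skew hB.symm hB.pos f ?_, ?_⟩
  · intro u v
    rw [hf, hf]
    exact hB.isAdInvariant.lie x u v
  · let F : Module.End ℝ (EuclideanSpace ℝ (Fin n)) := (adCLM (n := n) G x).toLinearMap
    have h1 : aeval F (minpoly ℝ f) = 0 := minpoly.aeval ℝ f
    have h2 := aeval_algHom_apply
      (Module.End.toContinuousLinearMap (EuclideanSpace ℝ (Fin n))).toAlgHom F (minpoly ℝ f)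
    rw [h1, map_zero] at h2
    exact h2

/-- Near `x`, two points of the orbit of `x` whose difference lies in `ann(x)` coincide: the
operators `ad` of the points of the orbit have the same minimal polynomial, which is separable, so
the difference is central. This is what replaces the embeddedness of the orbit: in a neighbourhood
of `x`, a point of the orbit is determined by its component in `ann(x)^⊥`. -/
theorem eventually_eq_of_sub_mem_ann [ConnectedSpace G] (hB : IsInvariantScalarProduct B)
    (x : GroupLieAlgebra (𝓡 n) G) :
    ∀ᶠ z : GroupLieAlgebra (𝓡 n) G × GroupLieAlgebra (𝓡 n) G in 𝓝 (x, x), ∀ g h : G,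
      Ad g x = z.1 → Ad h x = z.2 → ⁅z.1 - z.2, x⁆ = 0 → z.1 = z.2 := by
  have hB' := hB.isAdInvariant
  obtain ⟨q, hcop, hroot⟩ := exists_separable_aeval_adCLM hB x
  have hev := eventually_eq_of_aeval_eq q (adCLM G x) hcop hroot
  have hcont : Tendsto (fun z : EuclideanSpace ℝ (Fin n) × EuclideanSpace ℝ (Fin n) =>
      (adCLM G z.1, adCLM G z.2)) (𝓝 (x, x)) (𝓝 (adCLM G x, adCLM G x)) := by
    have := continuous_adCLM (n := n) G
    exact Continuous.tendsto' (by fun_prop) _ _ rfl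
  filter_upwards [hcont.eventually hev] with z hz g h hg hh hzx
  -- the operators `ad (Ad k x)` are conjugate to `ad x`
  have hrootg : ∀ k : G, aeval (adCLM (n := n) G (Ad k x)) q = 0 := by
    intro k
    have h1 := semiconjBy_aeval (adCLM_Ad k x) q
    rw [hroot] at h1
    have h2 : aeval (adCLM (n := n) G (Ad k x)) q * adOp k = 0 := by
      have := h1.eq
      rw [mul_zero] at this
      exact this.symm
    have h3 := congrArg (· * adOp (n := n) k⁻¹) h2
    simpa only [mul_assoc, ← adOp_mul, adOp_one, mul_inv_cancel, mul_one, zero_mul] using h3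
  have hroots : aeval (adCLM (n := n) G z.1) q = aeval (adCLM G z.2) q := by
    rw [← hg, ← hh, hrootg, hrootg]
  have h1 := hz hroots (by rw [← adCLM_sub]; exact commute_adCLM hzx)
  -- the difference is central, hence orthogonal to itself
  have hcentral : ∀ ξ : GroupLieAlgebra (𝓡 n) G, ⁅ξ, z.1 - z.2⁆ = 0 := by
    intro ξ
    have h2 : adCLM (n := n) G (z.1 - z.2 : GroupLieAlgebra (𝓡 n) G) = 0 := by
      rw [adCLM_sub]
      exact sub_eq_zero.2 h1
    rw [← lie_skew, neg_eq_zero]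
    exact (adCLM_apply (z.1 - z.2) ξ).symm.trans (DFunLike.congr_fun h2 ξ)
  have hfix : ∀ k : G, B (Ad k x) (z.1 - z.2) = B x (z.1 - z.2) := by
    intro k
    conv_lhs => rw [← Ad_eq_self_of_central hcentral k]
    exact hB.inv k _ _
  have h0 : B (z.1 - z.2) (z.1 - z.2) = 0 := by
    rw [LinearMap.map_sub₂, sub_eq_zero]
    exact (congrArg (fun u => B u (z.1 - z.2)) hg).symm.trans
      ((hfix g).trans ((hfix h).symm.trans (congrArg (fun u => B u (z.1 - z.2)) hh)))
  exact sub_eq_zero.1 (hB'.eq_zero h0)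

theorem mem_adjointOrbit_iff (hx : x ∈ adjointOrbit a) {y : GroupLieAlgebra (𝓡 n) G} :
    y ∈ adjointOrbit a ↔ ∃ g : G, Ad g x = y := by
  obtain ⟨k, rfl⟩ := hx
  constructor
  · rintro ⟨g, rfl⟩
    exact ⟨g * k⁻¹, by simp only [Ad_mul, Ad_inv_Ad]⟩
  · rintro ⟨g, rfl⟩
    exact ⟨g * k, Ad_mul g k a⟩

/-- A differentiable curve in the orbit of `x` through `x` comes from a differentiable curve in
the group, with velocity in `ann(x)^⊥`. -/
theorem exists_lift_of_isCurveIn [ConnectedSpace G] (hB : IsInvariantScalarProduct B)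
    (hx : x ∈ adjointOrbit a) {Y : GroupLieAlgebra (𝓡 n) G} {γ : ℝ → GroupLieAlgebra (𝓡 n) G}
    (hγ : IsCurveIn (adjointOrbit a) x Y γ) :
    ∃ (g : ℝ → G) (ξ : GroupLieAlgebra (𝓡 n) G), ξ ∈ annPerp B x ∧ IsGroupCurve g ξ ∧
      ∀ᶠ s in 𝓝 0, Ad (g s) x = γ s := by
  have hB' := hB.isAdInvariant
  -- lift the component of the curve in `ann(x)^⊥`, with the submersion `z ↦ Ad z x`
  let P₀ : GroupLieAlgebra (𝓡 n) G →ₗ[ℝ] GroupLieAlgebra (𝓡 n) G :=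
    Submodule.projection (annPerp B x) (ann x) (hB'.isCompl x).symm
  have hP1 : ∀ v, P₀ v ∈ annPerp B x := Submodule.projection_apply_mem _
  have hP2 : ∀ v, v - P₀ v ∈ ann x := by
    intro v
    rw [← Submodule.projection_eq_self_sub_projection]
    exact Submodule.projection_apply_mem _ v
  have hP3 : ∀ v, P₀ (P₀ v) = P₀ v := fun v => (Submodule.projection_eq_self_iff _ _).2 (hP1 v)
  let P : EuclideanSpace ℝ (Fin n) →L[ℝ] EuclideanSpace ℝ (Fin n) :=
    LinearMap.toContinuousLinearMap (𝕜 := ℝ) (E := EuclideanSpace ℝ (Fin n))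
      (F' := EuclideanSpace ℝ (Fin n)) P₀
  have hΦ : HasStrictFDerivAt (fun z => adjointChart n G z (x : EuclideanSpace ℝ (Fin n)))
      ((fderiv ℝ (adjointChart n G) (chartOne n G 1)).flip x) (chartOne n G 1) :=
    hasStrictFDerivAt_adjointChart.clm_apply_const x
  have hinj : ∀ v, P (((fderiv ℝ (adjointChart n G) (chartOne n G 1)).flip x) (P v)) = 0 →
      P v = 0 := by
    intro v hv
    have h1 : P₀ ⁅P₀ v, x⁆ = 0 :=
      (congrArg P₀ (adCLM_apply (P₀ v) x)).symm.trans hv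
    have h2 := hP2 ⁅P₀ v, x⁆
    rw [h1, sub_zero] at h2
    have h3 := hB'.eq_zero_of_mem h2 (hB'.lie_mem_annPerp _ _)
    exact hB'.eq_zero_of_mem h3 (hP1 v)
  have h0 : γ 0 = adjointChart n G (chartOne n G 1) x := by
    rw [hγ.base, adjointChart_one]
    rfl
  obtain ⟨y, η, hy0, hy, hPy⟩ := exists_lift_curve (E := EuclideanSpace ℝ (Fin n)) hΦ (P := P)
    hP3 hinj h0 hγ.deriv
  have hg : IsGroupCurve (fun s => (chartOne n G).symm (y s)) (P₀ η) := isAdCurve_chartOne hy0 hy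
  refine ⟨_, P₀ η, hP1 η, hg, ?_⟩
  have hlim : Tendsto (fun s => (Ad ((chartOne n G).symm (y s)) x, γ s)) (𝓝 0) (𝓝 (x, x)) := by
    refine Tendsto.prodMk_nhds ?_ ?_
    · have h1 : Tendsto (fun s => Ad ((chartOne n G).symm (y s)) x) (𝓝 0)
          (𝓝 (Ad ((chartOne n G).symm (y 0)) x)) :=
        HasDerivAt.continuousAt (F := EuclideanSpace ℝ (Fin n)) (hg.hasDerivAt_const x)
      rwa [hg.base, Ad_one] at h1
    · have h1 := (HasDerivAt.continuousAt (F := EuclideanSpace ℝ (Fin n)) hγ.deriv).tendsto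
      exact hγ.base ▸ h1
  filter_upwards [hlim.eventually (eventually_eq_of_sub_mem_ann hB x), hPy, hγ.mem] with s h1 h2 h3
  obtain ⟨k, hk⟩ := (mem_adjointOrbit_iff hx).1 h3
  refine h1 _ k rfl hk ?_
  have h4 : P₀ (Ad ((chartOne n G).symm (y s)) x - γ s) = 0 := by
    rw [map_sub, sub_eq_zero]
    exact h2
  have h5 := hP2 (Ad ((chartOne n G).symm (y s)) x - γ s)
  rw [h4, sub_zero] at h5
  exact h5

end Orbit

/-! ### The algebraic form of the momentum equation -/

section MagneticAlgebra

variable {L : Type*} [LieRing L] [LieAlgebra ℝ L] [FiniteDimensional ℝ L]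
  {B : LinearMap.BilinForm ℝ L}

/-- The two conditions that determine the momentum component `w` of the Hamiltonian vector field:
tangency to the cotangent bundle fixes its `ann(x)`-part, and the Hamilton equations, in the form
of a condition on `[x, w]`, fix the part in `ann(x)^⊥`. -/
theorem IsAdInvariant.tangent_and_lie_eq_iff (hB : IsAdInvariant B) {x p v w : L} {ε : ℝ}
    (hv : v ∈ annPerp B x) (hpv : ⁅p, v⁆ ∈ annPerp B x) (hp : p ∈ annPerp B x) :
    ((∃ ξ : L, ∃ π ∈ annPerp B x, v = ⁅ξ, x⁆ ∧ w = ⁅ξ, p⁆ + π) ∧ ⁅x, w⁆ = ⁅p, v⁆ - ε • v) ↔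
      w = adInv B x ⁅p, v⁆ - orthProj B (ann x) ⁅adInv B x v, p⁆ - ε • adInv B x v := by
  obtain ⟨h1, h2⟩ := hB.adInv_spec hv
  obtain ⟨h3, h4⟩ := hB.adInv_spec hpv
  obtain ⟨h5, h6⟩ := hB.orthProj_ann_spec x ⁅adInv B x v, p⁆
  constructor
  · rintro ⟨⟨ξ, π, hπ, hξ, hw⟩, hlie⟩
    obtain ⟨w₁, hw₁, w₂, hw₂, hsum⟩ := hB.exists_add x w
    have hw₁' : ⁅x, w₁⁆ = 0 := by rw [← lie_skew, mem_ann.1 hw₁, neg_zero]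
    have hperp : w₂ = adInv B x ⁅p, v⁆ - ε • adInv B x v := by
      refine (hB.bijOn_lie x).injOn hw₂
        (Submodule.sub_mem _ h3 (Submodule.smul_mem _ ε h1)) ?_
      show ⁅x, w₂⁆ = ⁅x, adInv B x ⁅p, v⁆ - ε • adInv B x v⁆
      rw [lie_sub, lie_smul, h2, h4, ← hlie, ← hsum, lie_add, hw₁', zero_add]
    have hann : orthProj B (ann x) ⁅adInv B x v, p⁆ = -w₁ := by
      refine hB.orthProj_ann_eq (Submodule.neg_mem _ hw₁) ?_
      -- `ξ` and `-ad_x⁻¹ v` both generate `v`, so they differ by an element of `ann(x)`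
      have hζ : ⁅ξ + adInv B x v, x⁆ = 0 := by
        rw [add_lie, ← hξ, ← lie_skew, h2, add_neg_cancel]
      have h7 := hB.mem_annPerp_of_lie_mem hp hζ
      have h8 : ⁅adInv B x v, p⁆ - -w₁ = ⁅ξ + adInv B x v, p⁆ + (π - w₂) := by
        rw [add_lie, eq_sub_of_add_eq hsum, hw]
        abel
      rw [h8]
      exact Submodule.add_mem _ h7 (Submodule.sub_mem _ hπ hw₂)
    rw [hann, ← hsum, hperp]
    abel
  · intro hw
    have hann' : ⁅x, orthProj B (ann x) ⁅adInv B x v, p⁆⁆ = 0 := by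
      rw [← lie_skew, mem_ann.1 h5, neg_zero]
    refine ⟨⟨-adInv B x v, w + ⁅adInv B x v, p⁆, ?_, ?_, ?_⟩, ?_⟩
    · have h7 : w + ⁅adInv B x v, p⁆ = adInv B x ⁅p, v⁆ - ε • adInv B x v +
          (⁅adInv B x v, p⁆ - orthProj B (ann x) ⁅adInv B x v, p⁆) := by
        rw [hw]
        abel
      rw [h7]
      exact Submodule.add_mem _ (Submodule.sub_mem _ h3 (Submodule.smul_mem _ ε h1)) h6
    · rw [neg_lie, lie_skew, h2]
    · rw [neg_lie]
      abel
    · rw [hw, lie_sub, lie_sub, lie_smul, h4, hann', h2, sub_zero]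

end MagneticAlgebra

/-! ### The cotangent bundle of an adjoint orbit -/

section Cotangent

open Filter

variable {n : ℕ} {G : Type*} [TopologicalSpace G] [ChartedSpace (EuclideanSpace ℝ (Fin n)) G]
  [Group G]
  {B : LinearMap.BilinForm ℝ (GroupLieAlgebra (𝓡 n) G)} {a x p : GroupLieAlgebra (𝓡 n) G}

/-- The Lie algebra carries no norm, so uniqueness of derivatives is taken from the model space. -/
theorem hasDerivAt_groupLieAlgebra_unique {γ γ' : ℝ → GroupLieAlgebra (𝓡 n) G}
    {Y Y' : GroupLieAlgebra (𝓡 n) G} (h : HasDerivAt γ Y 0) (h' : HasDerivAt γ' Y' 0)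
    (heq : ∀ᶠ s in 𝓝 0, γ s = γ' s) : Y = Y' :=
  HasDerivAt.unique (F := EuclideanSpace ℝ (Fin n)) h
    (HasDerivAt.congr_of_eventuallyEq (F := EuclideanSpace ℝ (Fin n)) h' heq)

theorem hasDerivAt_groupLieAlgebra_prod {γ : ℝ → GroupLieAlgebra (𝓡 n) G × GroupLieAlgebra (𝓡 n) G}
    {Y : GroupLieAlgebra (𝓡 n) G × GroupLieAlgebra (𝓡 n) G} {t : ℝ} :
    HasDerivAt γ Y t ↔ HasDerivAt (fun s => (γ s).1) Y.1 t ∧ HasDerivAt (fun s => (γ s).2) Y.2 t :=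
  hasDerivAt_iff_fst_snd (E := EuclideanSpace ℝ (Fin n)) (F := EuclideanSpace ℝ (Fin n))

variable [LieGroup (𝓡 n) ∞ G]

theorem Ad_mem_adjointOrbit (hx : x ∈ adjointOrbit a) (g : G) : Ad g x ∈ adjointOrbit a :=
  (mem_adjointOrbit_iff hx).2 ⟨g, rfl⟩

theorem Ad_mem_annPerp (hB : IsInvariantScalarProduct B) (hp : p ∈ annPerp B x) (g : G) :
    Ad g p ∈ annPerp B (Ad g x) := by
  intro η hη
  have h1 : ⁅Ad g⁻¹ η, x⁆ = 0 := by
    have h2 : ⁅η, Ad g x⁆ = 0 := hη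
    have h3 := Ad_lie g⁻¹ η (Ad g x)
    rwa [h2, map_zero, Ad_inv_Ad, eq_comm] at h3
  rw [← Ad_Ad_inv g η]
  exact (hB.inv g _ _).trans (hp _ h1)

theorem Ad_inv_mem_annPerp (hB : IsInvariantScalarProduct B) {g : G}
    (hp : p ∈ annPerp B (Ad g x)) : Ad g⁻¹ p ∈ annPerp B x := by
  have h := Ad_mem_annPerp hB hp g⁻¹
  rwa [Ad_inv_Ad] at h

theorem IsGroupCurve.isCurveIn {g : ℝ → G} {ξ : GroupLieAlgebra (𝓡 n) G} (hg : IsGroupCurve g ξ)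
    (hx : x ∈ adjointOrbit a) : IsCurveIn (adjointOrbit a) x ⁅ξ, x⁆ (fun s => Ad (g s) x) where
  base := by rw [hg.base, Ad_one]
  mem := Eventually.of_forall fun s => Ad_mem_adjointOrbit hx (g s)
  deriv := hg.hasDerivAt_const x

/-- The vectors `([ξ, x], [ξ, p] + π')` with `π' ∈ ann(x)^⊥` are tangent to the cotangent bundle:
move by the group and, at the same time, inside the cotangent space. -/
theorem exists_curve_cotangent (hB : IsInvariantScalarProduct B) (hx : x ∈ adjointOrbit a)
    (hp : p ∈ annPerp B x) (ξ : GroupLieAlgebra (𝓡 n) G) {π' : GroupLieAlgebra (𝓡 n) G}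
    (hπ' : π' ∈ annPerp B x) :
    ∃ γ, IsCurveIn (cotangentOrbit B (adjointOrbit a)) (x, p) (⁅ξ, x⁆, ⁅ξ, p⁆ + π') γ := by
  obtain ⟨g, hg⟩ := exists_isGroupCurve ξ
  have hπ : HasDerivAt (fun s : ℝ => p + s • π') π' 0 :=
    hasDerivAt_add_smul_zero (E := EuclideanSpace ℝ (Fin n)) p π'
  refine ⟨fun s => (Ad (g s) x, Ad (g s) (p + s • π')), ?_, ?_, ?_⟩
  · rw [hg.base, zero_smul, add_zero, Ad_one, Ad_one]
  · exact Eventually.of_forall fun s => ⟨Ad_mem_adjointOrbit hx (g s),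
      Ad_mem_annPerp hB (Submodule.add_mem _ hp (Submodule.smul_mem _ s hπ')) (g s)⟩
  · refine hasDerivAt_groupLieAlgebra_prod.2 ⟨hg.hasDerivAt_const x, ?_⟩
    have h := hg.hasDerivAt_apply hπ
    rwa [zero_smul, add_zero] at h

variable [ConnectedSpace G]

/-- `T_x O(a) = ann(x)^⊥`. -/
theorem tangentVectors_adjointOrbit (hB : IsInvariantScalarProduct B) (hx : x ∈ adjointOrbit a) :
    tangentVectors (adjointOrbit a) x = annPerp B x := by
  have hB' := hB.isAdInvariant
  ext Y
  constructor
  · rintro ⟨γ, hγ⟩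
    obtain ⟨g, ξ, -, hg, hgγ⟩ := exists_lift_of_isCurveIn hB hx hγ
    rw [← hasDerivAt_groupLieAlgebra_unique (hg.hasDerivAt_const x) hγ.deriv hgγ]
    exact hB'.lie_mem_annPerp ξ x
  · intro hY
    obtain ⟨ξ, -, rfl⟩ := hB'.exists_lie_eq hY
    obtain ⟨g, hg⟩ := exists_isGroupCurve ξ
    exact ⟨_, hg.isCurveIn hx⟩

/-- Every element of `ann(x)` is the velocity of a curve in the stabilizer of `x`. -/
theorem exists_stabilizer_curve (hB : IsInvariantScalarProduct B) {η : GroupLieAlgebra (𝓡 n) G}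
    (hη : ⁅η, x⁆ = 0) : ∃ h : ℝ → G, IsGroupCurve h η ∧ ∀ᶠ s in 𝓝 0, Ad (h s) x = x := by
  -- `k` moves `x` with velocity `0`; the curve `g`, which also has velocity `0`, undoes this motion
  obtain ⟨k, hk⟩ := exists_isGroupCurve (G := G) η
  have hx : x ∈ adjointOrbit x := ⟨1, Ad_one x⟩
  have hγ := hk.isCurveIn hx
  obtain ⟨g, ξ, hξ, hg, hgk⟩ := exists_lift_of_isCurveIn hB hx hγ
  have h1 : ⁅ξ, x⁆ = ⁅η, x⁆ :=
    hasDerivAt_groupLieAlgebra_unique (hg.hasDerivAt_const x) hγ.deriv hgk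
  have h2 : ξ = 0 := hB.isAdInvariant.eq_zero_of_mem (h1.trans hη) hξ
  refine ⟨fun s => (g s)⁻¹ * k s, ?_, ?_⟩
  · have h3 := hg.inv.mul hk
    rwa [h2, neg_zero, zero_add] at h3
  · filter_upwards [hgk] with s hs
    rw [Ad_mul, ← hs, Ad_inv_Ad]

/-- A differentiable curve in the cotangent bundle is carried by a curve in the group from a curve
in the cotangent space of its starting point. -/
theorem exists_lift_cotangent (hB : IsInvariantScalarProduct B) (hx : x ∈ adjointOrbit a)
    {Y : GroupLieAlgebra (𝓡 n) G × GroupLieAlgebra (𝓡 n) G}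
    {γ : ℝ → GroupLieAlgebra (𝓡 n) G × GroupLieAlgebra (𝓡 n) G}
    (hγ : IsCurveIn (cotangentOrbit B (adjointOrbit a)) (x, p) Y γ) :
    ∃ (g : ℝ → G) (ξ : GroupLieAlgebra (𝓡 n) G) (π : ℝ → GroupLieAlgebra (𝓡 n) G)
      (π' : GroupLieAlgebra (𝓡 n) G), IsGroupCurve g ξ ∧ π 0 = p ∧ HasDerivAt π π' 0 ∧
      π' ∈ annPerp B x ∧ Y = (⁅ξ, x⁆, ⁅ξ, p⁆ + π') ∧
      ∀ᶠ s in 𝓝 0, π s ∈ annPerp B x ∧ γ s = (Ad (g s) x, Ad (g s) (π s)) := by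
  obtain ⟨hγ1, hγ2⟩ := hasDerivAt_groupLieAlgebra_prod.1 hγ.deriv
  have hγ0 : γ 0 = (x, p) := hγ.base
  have hcurve : IsCurveIn (adjointOrbit a) x Y.1 (fun s => (γ s).1) :=
    ⟨by rw [hγ0], hγ.mem.mono fun s hs => hs.1, hγ1⟩
  obtain ⟨g, ξ, -, hg, hgγ⟩ := exists_lift_of_isCurveIn hB hx hcurve
  have hπ : HasDerivAt (fun s => Ad (g s)⁻¹ (γ s).2) (⁅-ξ, (γ 0).2⁆ + Y.2) 0 :=
    hg.inv.hasDerivAt_apply hγ2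
  have hev : ∀ᶠ s in 𝓝 0, Ad (g s)⁻¹ (γ s).2 ∈ annPerp B x ∧
      γ s = (Ad (g s) x, Ad (g s) (Ad (g s)⁻¹ (γ s).2)) := by
    filter_upwards [hgγ, hγ.mem] with s hs hmem
    refine ⟨Ad_inv_mem_annPerp hB (by rw [hs]; exact hmem.2), ?_⟩
    rw [Ad_Ad_inv, hs]
  refine ⟨g, ξ, _, _, hg, ?_, hπ, ?_, ?_, hev⟩
  · rw [hγ0, hg.base, inv_one, Ad_one]
  · intro η hη
    have h1 : HasDerivAt (fun s => B η (Ad (g s)⁻¹ (γ s).2)) _ 0 :=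
      HasDerivAt.bilinForm (_root_.hasDerivAt_const (F := EuclideanSpace ℝ (Fin n)) 0 η) hπ
    have h2 : HasDerivAt (fun s => B η (Ad (g s)⁻¹ (γ s).2)) 0 0 :=
      (hasDerivAt_const (0 : ℝ) (0 : ℝ)).congr_of_eventuallyEq
        (hev.mono fun s hs => hs.1 η hη)
    have h3 := h1.unique h2
    have h4 : B (0 : GroupLieAlgebra (𝓡 n) G) (Ad (g 0)⁻¹ (γ 0).2) = 0 := by simp
    exact ((congrArg (· + B η (⁅-ξ, (γ 0).2⁆ + Y.2)) h4).trans (zero_add _)).symm.trans h3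
  · have h1 := hasDerivAt_groupLieAlgebra_unique (hg.hasDerivAt_const x) hγ1 hgγ
    rw [hγ0, h1, neg_lie, add_neg_cancel_left]

end Cotangent

/-! ### The Hamiltonian vector field of an invariant metric -/

section Cometric

open Filter

variable {n : ℕ} {G : Type*} [TopologicalSpace G] [ChartedSpace (EuclideanSpace ℝ (Fin n)) G]
  [Group G]

theorem hasDerivAt_linearMap_apply (A : GroupLieAlgebra (𝓡 n) G →ₗ[ℝ] GroupLieAlgebra (𝓡 n) G)
    {π : ℝ → GroupLieAlgebra (𝓡 n) G} {π' : GroupLieAlgebra (𝓡 n) G} {t : ℝ}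
    (h : HasDerivAt π π' t) : HasDerivAt (fun s => A (π s)) (A π') t :=
  (LinearMap.toContinuousLinearMap (𝕜 := ℝ) (E := EuclideanSpace ℝ (Fin n))
    (F' := EuclideanSpace ℝ (Fin n)) A).hasFDerivAt.comp_hasDerivAt t h

variable [LieGroup (𝓡 n) ∞ G]

/-- `A` is the inverse Legendre transformation at `x`, extended linearly to the Lie algebra, of a
metric `K` on the orbit of `a` which is `G`-invariant, so that the inverse Legendre transformations
at the points `Ad g x` are the conjugates of `A`. -/
structure IsInvariantCometric (B : LinearMap.BilinForm ℝ (GroupLieAlgebra (𝓡 n) G))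
    (a : GroupLieAlgebra (𝓡 n) G)
    (K : GroupLieAlgebra (𝓡 n) G → GroupLieAlgebra (𝓡 n) G → GroupLieAlgebra (𝓡 n) G → ℝ)
    (x : GroupLieAlgebra (𝓡 n) G)
    (A : GroupLieAlgebra (𝓡 n) G →ₗ[ℝ] GroupLieAlgebra (𝓡 n) G) : Prop where
  mem : ∀ p ∈ annPerp B x, A p ∈ annPerp B x
  symm : ∀ p ∈ annPerp B x, ∀ q ∈ annPerp B x, B (A p) q = B p (A q)
  legendre : ∀ (g : G), ∀ p ∈ annPerp B x,
    legendreInv B (adjointOrbit a) K (Ad g x) (Ad g p) = Ad g (A p)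

variable {B : LinearMap.BilinForm ℝ (GroupLieAlgebra (𝓡 n) G)}
  {a x p : GroupLieAlgebra (𝓡 n) G}
  {K : GroupLieAlgebra (𝓡 n) G → GroupLieAlgebra (𝓡 n) G → GroupLieAlgebra (𝓡 n) G → ℝ}
  {A : GroupLieAlgebra (𝓡 n) G →ₗ[ℝ] GroupLieAlgebra (𝓡 n) G}

/-- The trajectories, for a Hamiltonian vector field with components `U` and `W`. -/
theorem isMagneticTrajectory_iff {ε : ℝ}
    {U W : GroupLieAlgebra (𝓡 n) G → GroupLieAlgebra (𝓡 n) G → GroupLieAlgebra (𝓡 n) G}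
    (hX : ∀ x p u w : GroupLieAlgebra (𝓡 n) G, (x, p) ∈ cotangentOrbit B (adjointOrbit a) →
      (IsMagneticVector B (adjointOrbit a) K ε (x, p) (u, w) ↔ u = U x p ∧ w = W x p))
    (J : Set ℝ) (x p : ℝ → GroupLieAlgebra (𝓡 n) G) :
    IsMagneticTrajectory B (adjointOrbit a) K ε J x p ↔
      ∀ t ∈ J, (x t, p t) ∈ cotangentOrbit B (adjointOrbit a) ∧
        HasDerivAt x (U (x t) (p t)) t ∧ HasDerivAt p (W (x t) (p t)) t := by
  refine forall₂_congr fun t _ => and_congr_right fun ht => ?_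
  constructor
  · rintro ⟨⟨u, w⟩, hd, hm⟩
    obtain ⟨rfl, rfl⟩ := (hX _ _ _ _ ht).1 hm
    exact hasDerivAt_groupLieAlgebra_prod.1 hd
  · intro h
    exact ⟨(U (x t) (p t), W (x t) (p t)), hasDerivAt_groupLieAlgebra_prod.2 h,
      (hX _ _ _ _ ht).2 ⟨rfl, rfl⟩⟩

variable [ConnectedSpace G]

/-- The tangent vectors of the cotangent bundle: infinitesimal motions by the group, plus vertical
vectors. -/
theorem mem_tangentVectors_cotangentOrbit (hB : IsInvariantScalarProduct B)
    (hx : x ∈ adjointOrbit a) (hp : p ∈ annPerp B x)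
    {Y : GroupLieAlgebra (𝓡 n) G × GroupLieAlgebra (𝓡 n) G} :
    Y ∈ tangentVectors (cotangentOrbit B (adjointOrbit a)) (x, p) ↔
      ∃ ξ : GroupLieAlgebra (𝓡 n) G, ∃ π ∈ annPerp B x, Y.1 = ⁅ξ, x⁆ ∧ Y.2 = ⁅ξ, p⁆ + π := by
  constructor
  · rintro ⟨γ, hγ⟩
    obtain ⟨-, ξ, -, π', -, -, -, hπ', rfl, -⟩ := exists_lift_cotangent hB hx hγ
    exact ⟨ξ, π', hπ', rfl, rfl⟩
  · rintro ⟨ξ, π', hπ', h1, h2⟩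
    rw [Prod.ext (x := Y) (y := (⁅ξ, x⁆, ⁅ξ, p⁆ + π')) h1 h2]
    exact exists_curve_cotangent hB hx hp ξ hπ'

namespace IsInvariantCometric

variable (hA : IsInvariantCometric B a K x A)
include hA

/-- The infinitesimal invariance of `A` under the stabilizer of `x`. -/
theorem apply_lie (hB : IsInvariantScalarProduct B) {η : GroupLieAlgebra (𝓡 n) G}
    (hη : ⁅η, x⁆ = 0) (hp : p ∈ annPerp B x) : A ⁅η, p⁆ = ⁅η, A p⁆ := by
  obtain ⟨h, hh, hfix⟩ := exists_stabilizer_curve hB hη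
  refine hasDerivAt_groupLieAlgebra_unique (hasDerivAt_linearMap_apply A (hh.hasDerivAt_const p))
    (hh.hasDerivAt_const (A p)) ?_
  filter_upwards [hfix] with s hs
  have h1 : Ad (h s) p ∈ annPerp B x := by
    have := Ad_mem_annPerp hB hp (h s)
    rwa [hs] at this
  have h2 := hA.legendre 1 _ h1
  rw [Ad_one, Ad_one, Ad_one] at h2
  rw [← h2, ← hA.legendre (h s) p hp, hs]

/-- `[p, A p]` is tangent to the orbit at `x`: for `η ∈ ann(x)`, the number `⟨[p, A p], η⟩` equals
its negative, by the invariance of `A` under `ad η` and the symmetry of `A`. -/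
theorem lie_mem (hB : IsInvariantScalarProduct B) (hp : p ∈ annPerp B x) :
    ⁅p, A p⁆ ∈ annPerp B x := by
  have hB' := hB.isAdInvariant
  refine hB'.mem_annPerp_of_lie_right fun η hη => ?_
  have h1 : B ⁅p, A p⁆ η = -B p ⁅η, A p⁆ := by rw [hB'.lie', ← lie_skew, map_neg]
  have h2 : B p ⁅η, A p⁆ = B (A p) ⁅η, p⁆ := by
    rw [← hA.apply_lie hB hη hp, hA.symm p hp _ (hB'.mem_annPerp_of_lie_mem hp hη)]
  have h3 : B (A p) ⁅η, p⁆ = B ⁅p, A p⁆ η := by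
    rw [hB'.symm, hB'.lie', hB'.symm]
  linarith

/-- The differential of the Hamiltonian. The second term, in which the Kirillov-Kostant form
serves to write `⟨[p, A p], ξ⟩` as a function of `Y.1 = [ξ, x]`, comes from the invariance of the
Hamiltonian under the group. -/
theorem hasDerivAt_hamiltonian (hB : IsInvariantScalarProduct B) (hx : x ∈ adjointOrbit a)
    (hp : p ∈ annPerp B x) {Y : GroupLieAlgebra (𝓡 n) G × GroupLieAlgebra (𝓡 n) G}
    {γ : ℝ → GroupLieAlgebra (𝓡 n) G × GroupLieAlgebra (𝓡 n) G}
    (hγ : IsCurveIn (cotangentOrbit B (adjointOrbit a)) (x, p) Y γ) :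
    HasDerivAt (fun s => hamiltonian B (adjointOrbit a) K (γ s))
      (B (A p) Y.2 - kirillovForm B x ⁅p, A p⁆ Y.1) 0 := by
  have hB' := hB.isAdInvariant
  obtain ⟨g, ξ, π, π', -, hπ0, hπ, hπ', rfl, hev⟩ := exists_lift_cotangent hB hx hγ
  have h1 : HasDerivAt (fun s => (1 / 2) * B (π s) (A (π s)))
      ((1 / 2) * (B π' (A (π 0)) + B (π 0) (A π'))) 0 :=
    (HasDerivAt.bilinForm hπ (hasDerivAt_linearMap_apply A hπ)).const_mul _
  have h2 : (1 / 2) * (B π' (A (π 0)) + B (π 0) (A π')) =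
      B (A p) (⁅ξ, p⁆ + π') - kirillovForm B x ⁅p, A p⁆ ⁅ξ, x⁆ := by
    rw [hB'.kirillovForm_lie (hA.lie_mem hB hp), hπ0, ← hA.symm p hp π' hπ', map_add,
      hB'.symm π' (A p), hB'.symm (A p) ⁅ξ, p⁆, hB'.lie', hB'.symm ξ]
    ring
  rw [h2] at h1
  refine h1.congr_of_eventuallyEq ?_
  filter_upwards [hev] with s hs
  rw [hs.2, hamiltonian, hA.legendre _ _ hs.1, hB.inv]

/-- The Hamiltonian vector field on the cotangent bundle of the orbit. -/
theorem isMagneticVector_iff (hB : IsInvariantScalarProduct B) (hx : x ∈ adjointOrbit a)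
    (hp : p ∈ annPerp B x) (ε : ℝ) (u w : GroupLieAlgebra (𝓡 n) G) :
    IsMagneticVector B (adjointOrbit a) K ε (x, p) (u, w) ↔
      u = A p ∧ w = adInv B x ⁅p, A p⁆ - orthProj B (ann x) ⁅adInv B x (A p), p⁆
        - ε • adInv B x (A p) := by
  have hB' := hB.isAdInvariant
  have hv := hA.mem p hp
  have hpv := hA.lie_mem hB hp
  rw [← hB'.tangent_and_lie_eq_iff hv hpv hp]
  constructor
  · rintro ⟨ht, hham⟩
    obtain ⟨ξ₀, π₀, hπ₀, h1, h2⟩ := (mem_tangentVectors_cotangentOrbit hB hx hp).1 ht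
    have h1' : u = ⁅ξ₀, x⁆ := h1
    have key : ∀ ξ : GroupLieAlgebra (𝓡 n) G, ∀ π ∈ annPerp B x,
        B (A p) (⁅ξ, p⁆ + π) - B ⁅p, A p⁆ ξ =
          -(B w ⁅ξ, x⁆ - B (⁅ξ, p⁆ + π) u + ε * B u ξ) := by
      intro ξ π hπ
      obtain ⟨γ, hγ⟩ := exists_curve_cotangent hB hx hp ξ hπ
      have h3 := (hA.hasDerivAt_hamiltonian hB hx hp hγ).unique (hham _ γ hγ)
      rw [hB'.kirillovForm_lie hpv] at h3
      have h4 := hB'.kirillovForm_lie (x := x) (u := u)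
        (by rw [h1']; exact hB'.lie_mem_annPerp _ _) ξ
      rw [h3, magneticForm, ← h4]
    -- the vertical test vectors determine `u`
    have hu : u = A p := by
      have h3 : u - A p ∈ annPerp B x :=
        Submodule.sub_mem _ (by rw [h1']; exact hB'.lie_mem_annPerp _ _) hv
      have h4 := key 0 _ h3
      refine sub_eq_zero.1 (hB'.eq_zero ?_)
      rw [zero_lie, zero_lie, zero_add, map_zero, map_zero, map_zero,
        hB'.symm (A p) (u - A p)] at h4
      rw [map_sub]
      linarith
    -- the test vectors given by the action of the group determine `[x, w]`
    refine ⟨hu, ⟨ξ₀, π₀, hπ₀, hu ▸ h1', h2⟩, hB'.ext_left fun ξ => ?_⟩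
    have h3 := key ξ 0 (Submodule.zero_mem _)
    rw [add_zero, hu, hB'.symm (A p) ⁅ξ, p⁆, hB'.inner_lie_right] at h3
    rw [LinearMap.map_sub₂, LinearMap.map_smul₂, smul_eq_mul]
    linarith
  · rintro ⟨rfl, ⟨ξ₀, π₀, hπ₀, h1, h2⟩, hlie⟩
    refine ⟨(mem_tangentVectors_cotangentOrbit hB hx hp).2 ⟨ξ₀, π₀, hπ₀, h1, h2⟩,
      fun Y γ hγ => ?_⟩
    convert hA.hasDerivAt_hamiltonian hB hx hp hγ using 1
    obtain ⟨ξ, π, hπ, h3, h4⟩ := (mem_tangentVectors_cotangentOrbit hB hx hp).1 ⟨γ, hγ⟩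
    have h5 := congrArg (fun z => B z ξ) hlie
    simp only [LinearMap.map_sub₂, LinearMap.map_smul₂, smul_eq_mul] at h5
    have h6 : magneticForm B ε x (A p, w) Y =
      B w Y.1 - B Y.2 (A p) + ε * kirillovForm B x (A p) Y.1 := rfl
    show -magneticForm B ε x (A p, w) Y = _
    rw [h6, h3, hB'.kirillovForm_lie hv, hB'.kirillovForm_lie hpv,
      hB'.inner_lie_right, hB'.symm Y.2]
    linarith

end IsInvariantCometric

/-- `legendreInv` is an unspecified element with the defining property, so its value needs both
existence and uniqueness. -/
theorem legendreInv_eq (hB : IsInvariantScalarProduct B) (hx : x ∈ adjointOrbit a)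
    {v : GroupLieAlgebra (𝓡 n) G} (hv : v ∈ annPerp B x)
    (h : ∀ η ∈ annPerp B x, K x v η = B p η)
    (huniq : ∀ v' ∈ annPerp B x, (∀ η ∈ annPerp B x, K x v' η = B p η) → v' = v) :
    legendreInv B (adjointOrbit a) K x p = v := by
  have hT := tangentVectors_adjointOrbit hB hx
  have hex : ∃ v : GroupLieAlgebra (𝓡 n) G, v ∈ tangentVectors (adjointOrbit a) x ∧
      ∀ η ∈ tangentVectors (adjointOrbit a) x, K x v η = B p η := by
    rw [hT]
    exact ⟨v, hv, h⟩
  have h1 := Classical.epsilon_spec hex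
  refine huniq _ ?_ ?_
  · exact (Set.ext_iff.1 hT _).1 h1.1
  · intro η hη
    exact h1.2 η (by rw [hT]; exact hη)

end Cometric

/-! ### The normal metric -/

section NormalMetric

variable {n : ℕ} {G : Type*} [TopologicalSpace G] [ChartedSpace (EuclideanSpace ℝ (Fin n)) G]
  [Group G] [LieGroup (𝓡 n) ∞ G]

/-- The inverse Legendre transformation `p ↦ [[x, p], x]` of the normal metric at `x`. -/
def normalCometric (x : GroupLieAlgebra (𝓡 n) G) :
    GroupLieAlgebra (𝓡 n) G →ₗ[ℝ] GroupLieAlgebra (𝓡 n) G where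
  toFun p := ⁅⁅x, p⁆, x⁆
  map_add' p q := by rw [lie_add, add_lie]
  map_smul' c p := by rw [lie_smul, smul_lie, RingHom.id_apply]

variable [ConnectedSpace G] {B : LinearMap.BilinForm ℝ (GroupLieAlgebra (𝓡 n) G)}
  {a x p : GroupLieAlgebra (𝓡 n) G}

theorem legendreInv_normalMetric (hB : IsInvariantScalarProduct B) (hx : x ∈ adjointOrbit a)
    (p : GroupLieAlgebra (𝓡 n) G) :
    legendreInv B (adjointOrbit a) (normalMetric B) x p = ⁅⁅x, p⁆, x⁆ := by
  have hB' := hB.isAdInvariant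
  have h1 : orbitGen B x ⁅⁅x, p⁆, x⁆ = ⁅x, p⁆ :=
    hB'.orbitGen_eq (hB'.lie_mem_annPerp' p x) rfl
  have h2 : ∀ η ∈ annPerp B x, normalMetric B x ⁅⁅x, p⁆, x⁆ η = B p η := by
    intro η hη
    rw [normalMetric, h1, ← hB'.inner_lie_right, (hB'.orbitGen_spec hη).2]
  refine legendreInv_eq hB hx (hB'.lie_mem_annPerp _ x) h2 fun v' hv' h => ?_
  obtain ⟨h3, h4⟩ := hB'.orbitGen_spec hv'
  have h5 : orbitGen B x v' - ⁅x, p⁆ ∈ annPerp B x :=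
    Submodule.sub_mem _ h3 (hB'.lie_mem_annPerp' p x)
  have h6 := h _ (hB'.lie_mem_annPerp (orbitGen B x v' - ⁅x, p⁆) x)
  rw [← h2 _ (hB'.lie_mem_annPerp _ x), normalMetric, normalMetric, h1,
    hB'.orbitGen_eq h5 rfl, ← sub_eq_zero, ← LinearMap.map_sub₂] at h6
  rw [← h4, sub_eq_zero.1 (hB'.eq_zero h6)]

/-- The normal metric is `G`-invariant because `Ad g` is an automorphism of the Lie algebra. -/
theorem isInvariantCometric_normalMetric (hB : IsInvariantScalarProduct B)
    (hx : x ∈ adjointOrbit a) :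
    IsInvariantCometric B a (normalMetric B) x (normalCometric x) where
  mem p _ := hB.isAdInvariant.lie_mem_annPerp _ x
  symm p _ q _ := by
    have hB' := hB.isAdInvariant
    show B ⁅⁅x, p⁆, x⁆ q = B p ⁅⁅x, q⁆, x⁆
    rw [hB'.lie', hB'.inner_lie_right x p]
  legendre g p _ := by
    rw [legendreInv_normalMetric hB (Ad_mem_adjointOrbit hx g), ← Ad_lie, ← Ad_lie]
    rfl

/-- For the normal metric the momentum equation simplifies: `[[x, p], p] + ε [x, p]` satisfies, with
`ξ = [x, p]` and vertical part `ε [x, p]`, the two conditions that determine `w`. -/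
theorem isMagneticVector_normalMetric_iff (hB : IsInvariantScalarProduct B)
    (hx : x ∈ adjointOrbit a) (hp : p ∈ annPerp B x) (ε : ℝ) (u w : GroupLieAlgebra (𝓡 n) G) :
    IsMagneticVector B (adjointOrbit a) (normalMetric B) ε (x, p) (u, w) ↔
      u = ⁅⁅x, p⁆, x⁆ ∧ w = ⁅⁅x, p⁆, p⁆ + ε • ⁅x, p⁆ := by
  have hB' := hB.isAdInvariant
  have hA := isInvariantCometric_normalMetric hB hx
  have h1 : ⁅x, ⁅⁅x, p⁆, p⁆⁆ = ⁅p, ⁅⁅x, p⁆, x⁆⁆ := by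
    rw [leibniz_lie x ⁅x, p⁆ p, lie_self, add_zero, ← lie_skew, ← lie_skew x, lie_neg, neg_neg]
  have hform := (hB'.tangent_and_lie_eq_iff (ε := ε) (w := ⁅⁅x, p⁆, p⁆ + ε • ⁅x, p⁆)
    (hA.mem p hp) (hA.lie_mem hB hp) hp).1
    ⟨⟨⁅x, p⁆, ε • ⁅x, p⁆, Submodule.smul_mem _ ε (hB'.lie_mem_annPerp' p x), rfl, rfl⟩, by
      show _ = ⁅p, ⁅⁅x, p⁆, x⁆⁆ - ε • ⁅⁅x, p⁆, x⁆
      rw [lie_add, lie_smul, h1, ← lie_skew x ⁅x, p⁆, smul_neg, sub_eq_add_neg]⟩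
  rw [hA.isMagneticVector_iff hB hx hp, ← hform]
  rfl

end NormalMetric

/-! ### The metrics defined by invariant operators -/

section InvariantMetric

variable {n : ℕ} {G : Type*} [TopologicalSpace G] [ChartedSpace (EuclideanSpace ℝ (Fin n)) G]
  [Group G] [LieGroup (𝓡 n) ∞ G] {B : LinearMap.BilinForm ℝ (GroupLieAlgebra (𝓡 n) G)}
  {a x p : GroupLieAlgebra (𝓡 n) G} {φ : annPerp B a →ₗ[ℝ] annPerp B a}

theorem exists_Ad_eq (hB : IsInvariantScalarProduct B) (g : G) (hp : p ∈ annPerp B (Ad g a)) :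
    ∃ v : annPerp B a, Ad g v = p :=
  ⟨⟨Ad g⁻¹ p, Ad_inv_mem_annPerp hB hp⟩, Ad_Ad_inv g p⟩

theorem IsInvariantOperator.injective (hφ : IsInvariantOperator B a φ) :
    Function.Injective φ := by
  rw [injective_iff_map_eq_zero]
  intro v hv
  by_contra hne
  have h := hφ.pos v hne
  rw [hv, ZeroMemClass.coe_zero, LinearMap.map_zero₂] at h
  exact lt_irrefl _ h

/-- A positive definite operator on `ann(a)^⊥`, as a linear equivalence. -/
def IsInvariantOperator.equiv (hφ : IsInvariantOperator B a φ) : annPerp B a ≃ₗ[ℝ] annPerp B a :=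
  LinearEquiv.ofInjectiveEndo φ hφ.injective

theorem IsInvariantOperator.apply_equiv_symm (hφ : IsInvariantOperator B a φ) (v : annPerp B a) :
    φ (hφ.equiv.symm v) = v :=
  hφ.equiv.apply_symm_apply v

variable [ConnectedSpace G]

theorem bijOn_phiAt (hB : IsInvariantScalarProduct B) (hφ : IsInvariantOperator B a φ)
    (hx : x ∈ adjointOrbit a) :
    Set.BijOn (phiAt φ x) (tangentVectors (adjointOrbit a) x)
      (tangentVectors (adjointOrbit a) x) := by
  rw [tangentVectors_adjointOrbit hB hx]
  obtain ⟨g, rfl⟩ := hx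
  refine ⟨fun p hp => ?_, fun p hp q hq h => ?_, fun p hp => ?_⟩
  · obtain ⟨v, rfl⟩ := exists_Ad_eq hB g hp
    have h := Ad_mem_annPerp hB (φ v).2 g
    rwa [← phiAt_Ad hφ] at h
  · obtain ⟨v, rfl⟩ := exists_Ad_eq hB g hp
    obtain ⟨w, rfl⟩ := exists_Ad_eq hB g hq
    have h1 : Ad g (φ v : GroupLieAlgebra (𝓡 n) G) = Ad g (φ w : GroupLieAlgebra (𝓡 n) G) := by
      rw [← phiAt_Ad hφ, ← phiAt_Ad hφ]
      exact h
    have h2 := congrArg (Ad g⁻¹) h1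
    rw [Ad_inv_Ad, Ad_inv_Ad] at h2
    rw [hφ.injective (Subtype.ext h2)]
  · obtain ⟨v, rfl⟩ := exists_Ad_eq hB g hp
    refine ⟨Ad g (hφ.equiv.symm v), Ad_mem_annPerp hB (hφ.equiv.symm v).2 g, ?_⟩
    have h := phiAt_Ad hφ g (hφ.equiv.symm v)
    rw [hφ.apply_equiv_symm] at h
    exact h

theorem phiInvAt_Ad (hB : IsInvariantScalarProduct B) (hφ : IsInvariantOperator B a φ) (g : G)
    (v : annPerp B a) : phiInvAt φ (Ad g a) (Ad g v) = Ad g (hφ.equiv.symm v) := by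
  have hx : Ad g a ∈ adjointOrbit a := ⟨g, rfl⟩
  have hbij := bijOn_phiAt hB hφ hx
  have hT := tangentVectors_adjointOrbit hB hx
  have h1 : Ad g (hφ.equiv.symm v : GroupLieAlgebra (𝓡 n) G) ∈
      tangentVectors (adjointOrbit a) (Ad g a) := by
    rw [hT]
    exact Ad_mem_annPerp hB (hφ.equiv.symm v).2 g
  have h2 : phiAt φ (Ad g a) (Ad g (hφ.equiv.symm v)) = Ad g v := by
    rw [phiAt_Ad hφ, hφ.apply_equiv_symm]
  have h3 := hbij.injOn.leftInvOn_invFunOn h1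
  rw [h2] at h3
  exact h3

theorem legendreInv_invariantMetric (hB : IsInvariantScalarProduct B)
    (hφ : IsInvariantOperator B a φ) (g : G) (v : annPerp B a) :
    legendreInv B (adjointOrbit a) (invariantMetric φ) (Ad g a) (Ad g v) =
      Ad g (hφ.equiv.symm v) := by
  have hx : Ad g a ∈ adjointOrbit a := ⟨g, rfl⟩
  refine legendreInv_eq hB hx (Ad_mem_annPerp hB (hφ.equiv.symm v).2 g) (fun η _ => ?_)
    fun v' hv' h => ?_
  · rw [invariantMetric, phiAt_Ad hφ, hφ.apply_equiv_symm]
  · obtain ⟨u, rfl⟩ := exists_Ad_eq hB g hv'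
    have h1 := h _ (Ad_mem_annPerp hB (φ u - v).2 g)
    rw [invariantMetric, phiAt_Ad hφ, hB.inv, hB.inv, ← sub_eq_zero, ← LinearMap.map_sub₂] at h1
    have h2 : φ u = v := Subtype.ext (sub_eq_zero.1 (hB.isAdInvariant.eq_zero h1))
    rw [hφ.equiv.symm_apply_eq.2 h2.symm]

/-- The inverse Legendre transformation of `K_φ` at `x = Ad g a` is `φ_x⁻¹`, extended by zero on
`ann(x)`. -/
theorem exists_isInvariantCometric (hB : IsInvariantScalarProduct B)
    (hφ : IsInvariantOperator B a φ) (hx : x ∈ adjointOrbit a) :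
    ∃ A : GroupLieAlgebra (𝓡 n) G →ₗ[ℝ] GroupLieAlgebra (𝓡 n) G,
      IsInvariantCometric B a (invariantMetric φ) x A ∧
        ∀ p ∈ annPerp B x, A p = phiInvAt φ x p := by
  obtain ⟨g, rfl⟩ := hx
  let A : GroupLieAlgebra (𝓡 n) G →ₗ[ℝ] GroupLieAlgebra (𝓡 n) G :=
    (Ad g).toLinearMap ∘ₗ (annPerp B a).subtype ∘ₗ hφ.equiv.symm.toLinearMap ∘ₗ
      (annPerp B a).projectionOnto (ann a) (hB.isAdInvariant.isCompl a).symm ∘ₗ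
      (Ad g⁻¹).toLinearMap
  have hA : ∀ v : annPerp B a, A (Ad g v) = Ad g (hφ.equiv.symm v) := by
    intro v
    show Ad g (hφ.equiv.symm ((annPerp B a).projectionOnto (ann a) _ (Ad g⁻¹ (Ad g v))) :
      GroupLieAlgebra (𝓡 n) G) = _
    rw [Ad_inv_Ad, Submodule.projectionOnto_apply_left]
  refine ⟨A, ⟨fun p hp => ?_, fun p hp q hq => ?_, fun h p hp => ?_⟩, fun p hp => ?_⟩
  · obtain ⟨v, rfl⟩ := exists_Ad_eq hB g hp
    rw [hA]
    exact Ad_mem_annPerp hB (hφ.equiv.symm v).2 g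
  · obtain ⟨v, rfl⟩ := exists_Ad_eq hB g hp
    obtain ⟨w, rfl⟩ := exists_Ad_eq hB g hq
    rw [hA, hA, hB.inv, hB.inv]
    have h1 := hφ.symm (hφ.equiv.symm v) (hφ.equiv.symm w)
    rw [hφ.apply_equiv_symm, hφ.apply_equiv_symm] at h1
    exact h1.symm
  · obtain ⟨v, rfl⟩ := exists_Ad_eq hB g hp
    rw [hA]
    have h1 := legendreInv_invariantMetric hB hφ (h * g) v
    simp only [Ad_mul] at h1
    exact h1
  · obtain ⟨v, rfl⟩ := exists_Ad_eq hB g hp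
    rw [hA]
    exact (phiInvAt_Ad hB hφ g v).symm

end InvariantMetric

end

theorem theorem2p1 {n : ℕ} {G : Type*} [TopologicalSpace G] [T2Space G] [CompactSpace G]
    [ConnectedSpace G] [ChartedSpace (EuclideanSpace ℝ (Fin n)) G] [Group G]
    [LieGroup (𝓡 n) ∞ G]
    (B : LinearMap.BilinForm ℝ (GroupLieAlgebra (𝓡 n) G)) (hB : IsInvariantScalarProduct B)
    (a : GroupLieAlgebra (𝓡 n) G) (φ : annPerp B a →ₗ[ℝ] annPerp B a)
    (hφ : IsInvariantOperator B a φ) (ε : ℝ) :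
    -- the inverses in the equations are those of bijections, applied to elements of their domains
    (∀ x p : GroupLieAlgebra (𝓡 n) G, (x, p) ∈ cotangentOrbit B (adjointOrbit a) →
      Set.BijOn (fun ξ => ⁅x, ξ⁆) (annPerp B x) (tangentVectors (adjointOrbit a) x) ∧
      Set.BijOn (phiAt φ x) (tangentVectors (adjointOrbit a) x)
        (tangentVectors (adjointOrbit a) x) ∧
      p ∈ tangentVectors (adjointOrbit a) x ∧
      ⁅p, phiInvAt φ x p⁆ ∈ tangentVectors (adjointOrbit a) x) ∧
    -- the magnetic geodesic vector field of the metric `K_φ`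
    (∀ x p u w : GroupLieAlgebra (𝓡 n) G, (x, p) ∈ cotangentOrbit B (adjointOrbit a) →
      (IsMagneticVector B (adjointOrbit a) (invariantMetric φ) ε (x, p) (u, w) ↔
        u = phiInvAt φ x p ∧
        w = adInv B x ⁅p, phiInvAt φ x p⁆
          - orthProj B (ann x) ⁅adInv B x (phiInvAt φ x p), p⁆
          - ε • adInv B x (phiInvAt φ x p))) ∧
    -- the trajectories of the magnetic geodesic flow of the metric `K_φ`
    (∀ (J : Set ℝ) (x p : ℝ → GroupLieAlgebra (𝓡 n) G),
      IsMagneticTrajectory B (adjointOrbit a) (invariantMetric φ) ε J x p ↔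
        ∀ t ∈ J, (x t, p t) ∈ cotangentOrbit B (adjointOrbit a) ∧
          HasDerivAt x (phiInvAt φ (x t) (p t)) t ∧
          HasDerivAt p (adInv B (x t) ⁅p t, phiInvAt φ (x t) (p t)⁆
            - orthProj B (ann (x t)) ⁅adInv B (x t) (phiInvAt φ (x t) (p t)), p t⁆
            - ε • adInv B (x t) (phiInvAt φ (x t) (p t))) t) ∧
    -- the magnetic geodesic vector field of the normal metric
    (∀ x p u w : GroupLieAlgebra (𝓡 n) G, (x, p) ∈ cotangentOrbit B (adjointOrbit a) →
      (IsMagneticVector B (adjointOrbit a) (normalMetric B) ε (x, p) (u, w) ↔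
        u = ⁅⁅x, p⁆, x⁆ ∧ w = ⁅⁅x, p⁆, p⁆ + ε • ⁅x, p⁆)) ∧
    -- the trajectories of the magnetic geodesic flow of the normal metric
    (∀ (J : Set ℝ) (x p : ℝ → GroupLieAlgebra (𝓡 n) G),
      IsMagneticTrajectory B (adjointOrbit a) (normalMetric B) ε J x p ↔
        ∀ t ∈ J, (x t, p t) ∈ cotangentOrbit B (adjointOrbit a) ∧
          HasDerivAt x ⁅⁅x t, p t⁆, x t⁆ t ∧
          HasDerivAt p (⁅⁅x t, p t⁆, p t⁆ + ε • ⁅x t, p t⁆) t) := by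
  have hφvec : ∀ x p u w : GroupLieAlgebra (𝓡 n) G,
      (x, p) ∈ cotangentOrbit B (adjointOrbit a) →
      (IsMagneticVector B (adjointOrbit a) (invariantMetric φ) ε (x, p) (u, w) ↔
        u = phiInvAt φ x p ∧
        w = adInv B x ⁅p, phiInvAt φ x p⁆
          - orthProj B (ann x) ⁅adInv B x (phiInvAt φ x p), p⁆
          - ε • adInv B x (phiInvAt φ x p)) := by
    rintro x p u w ⟨hx, hp⟩
    obtain ⟨A, hA, hAp⟩ := exists_isInvariantCometric hB hφ hx
    rw [← hAp p hp]
    exact hA.isMagneticVector_iff hB hx hp ε u w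
  have hvec : ∀ x p u w : GroupLieAlgebra (𝓡 n) G,
      (x, p) ∈ cotangentOrbit B (adjointOrbit a) →
      (IsMagneticVector B (adjointOrbit a) (normalMetric B) ε (x, p) (u, w) ↔
        u = ⁅⁅x, p⁆, x⁆ ∧ w = ⁅⁅x, p⁆, p⁆ + ε • ⁅x, p⁆) :=
    fun x p u w h => isMagneticVector_normalMetric_iff hB h.1 h.2 ε u w
  refine ⟨?_, hφvec, fun J x p => isMagneticTrajectory_iff hφvec J x p, hvec,
    fun J x p => isMagneticTrajectory_iff hvec J x p⟩
  rintro x p ⟨hx, hp⟩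
  obtain ⟨A, hA, hAp⟩ := exists_isInvariantCometric hB hφ hx
  refine ⟨?_, bijOn_phiAt hB hφ hx, ?_, ?_⟩
  · rw [tangentVectors_adjointOrbit hB hx]
    exact hB.isAdInvariant.bijOn_lie x
  · rw [tangentVectors_adjointOrbit hB hx]
    exact hp
  · rw [tangentVectors_adjointOrbit hB hx, ← hAp p hp]
    exact hA.lie_mem hB hp
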